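/- Let $[n]=\{1<\dots<n\}$. A column $c=(c^1;\dots;c^k)$ is a strictly increasing sequence in $[n]$, read from top to bottom, of length $|c|=k\ge 1$. A string of columns is a sequence $w=c_1|_{p_1}c_2|_{p_2}\cdots|_{p_m}c_{m+1}$ of columns with $p_k\in\mathbb Z$, where $c|_pc'$ means that the bottom box of $c'$ lies in row $p$ of $c$ (row $1$ being the row of the top box of $c$); the empty column is identified with the empty string, which is neutral for gluing. Let $\mathrm{Scol}_n$ be the set of strings of columns, and $\mathrm{Scol}^c_n$ the subset of those that are row connected (neighbouring columns share a row in which both have a box, and no row has a gap) and row increasing (entries weakly increase along rows). A skew tableau is an element of $\mathrm{Scol}_n^c$ with $p_k\le|c_{k+1}|$ for all $k$; a Young tableau is an element of $\mathrm{Scol}_n^c$ with $p_k=|c_{k+1}|$ and $|c_k|\ge|c_{k+1}|$ for all $k$. A rule $|_{p_s}u|_{q_s}\Rightarrow|_{p_t}v|_{q_t}$ rewrites $w_1|_{p_s}u|_{q_s}w_2$ into $w_1|_{p_t}v|_{q_t}w_2$ for all strings $w_1,w_2$ (a gluing position next to an empty string is dropped). Let $\mathcal{FS}_n$ be the rewriting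 system on $\mathrm{Scol}_n$ with the following rules, for all columns $a,b$ with $|a|=i_1$, $|b|=i_2$ and all $p',q'\in\mathbb Z$. Here a position $k$ is called good if $a|_kb\in\mathrm{Scol}^c_n$; $s_0$ is the largest good position, or $0$ if there is none; and, for a position $k$ at which there is an $l\le i_1$ such that $m=l-1+i_2-k$ satisfies $1\le m\le i_2$ and $a^{l-1}<b^m<a^l$ (the first inequality being void for $l=1$), one takes the least such $l$, lets $a'$ be $a$ with $b^m$ inserted as its new $l$-th entry and $b'$ be $b$ with $b^m$ removed, and calls $a'|_kb'$ (which is $a'$ if $b'$ is empty) the insertion at $k$. Left-sliding rules: (α) if $i_1\le m<i_2$ and $i_1+i_2-m$ is good, then $|_{p'}a|_{i_1+i_2-m}b|_{q'}\Rightarrow|_{p'}(a^1;\dots;a^{i_1};b^{m+1};\dots;b^{i_2})|_{i_1}(b^1;\dots;b^m)|_{q'}$; (δ^α) if $i_1+i_2-q$ is not good, $p$ is the least integer $\ge i_1$ such that $i_1+i_2-p$ is good, and $q<p<i_2$, then $|_{p'}a|_{i_1+i_2-q}b|_{q'}\Rightarrow|_{p'}(a^1;\dots;a^{i_1};b^{p+1};\dots;b^{i_2})|_{i_1}(b^1;\dots;b^p)|_{q'+(p-q)}$.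 Insert-sliding rules: (β) if $1\le k\le i_1$, $k<i_2$, $k$ is good and the insertion at $k$ exists, then $|_{p'}a|_kb|_{q'}\Rightarrow|_{p'}a'|_kb'|_{q'}$; (δ^β) if $r=i_1+i_2-q$ is not good, $p=s_0\le i_1$, $p<i_2$, $p<r$ or $p=0$, and the insertion at $p$ exists, then $|_{p'}a|_rb|_{q'}\Rightarrow|_{p'}a'|_pb'|_{q'+(i_1+i_2-p-q)}$. Top-sliding rules: (γ) if $r$ is good and $1\le r<i_2$, or $a|_rb$ is not row connected and $a^1\le b^{i_2}$, and if $s$ is the largest good position with $s\le i_2$ and $r<s$, then $|_{p'}a|_rb|_{q'}\Rightarrow|_{p'-(s-r)}a|_sb|_{q'}$; (δ) if $p<i_1$ and $r=i_1+i_2-p$, and either $r$ is not good and $i_2$ is good, or $r$ is good, or $a|_rb$ is not row connected, $r>i_1$ and $a^{i_1}\le b^1$, then $|_{p'}a|_rb|_{q'}\Rightarrow|_{p'}a|_{i_2}b|_{q'+(i_1-p)}$. Theorem. The rewriting system $\mathcal{FS}_n$ is convergent, that is, there is no infinite rewriting path and any two rewriting paths from the same string can be continued to a common string; in particular every string of columns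 $w$ has a unique normal form $\mathrm{nf}(w,\mathcal{FS}_n)$. The normal form of any skew tableau is a Young tableau. Moreover, for every word $w$ over $[n]$, $$C_{\mathbb Y^{row}_n}(w)=\mathrm{nf}([w]_s,\mathcal{FS}_n)\quad\text{and}\quad C_{\mathbb Y^{col}_n}(w)=\mathrm{nf}([w]_s,\mathcal{FS}_n),$$ where $[w]_s$ is the diagonal skew tableau of $w$ (the maximal strictly decreasing factors of $w$ are the bottom to top readings of its columns, all glued at position $1$), $C_{\mathbb Y^{row}_n}(w)$ is the Young tableau obtained by inserting the letters of $w$ from left to right in the empty tableau by Schensted's row insertion ($x$ bumps the leftmost entry $>x$), and $C_{\mathbb Y^{col}_n}(w)$ is the one obtained by inserting the letters of $w$ from right to left by Schensted's column insertion ($x$ bumps the topmost entry $\ge x$). -/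

import Mathlib

namespace JeuDeTaquin

/-! ## Columns and strings of columns

The alphabet `[n] = {1 < ⋯ < n}` is `Fin n`. Rows are numbered from top to bottom. -/

/-- A list `(c¹; …; cᵏ)` is (the top to bottom content of) a nonempty column when it is nonempty and
strictly increasing. -/
def IsColumn {n : ℕ} (l : List (Fin n)) : Prop := l ≠ [] ∧ l.Pairwise (· < ·)

instance {n : ℕ} (l : List (Fin n)) : Decidable (IsColumn l) := by
  unfold IsColumn; infer_instance

/-- A nonempty column over `[n]`, its entries listed from top to bottom. -/
@[ext] structure Column (n : ℕ) where
  entries : List (Fin n)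
  isColumn : IsColumn entries

namespace Column

/-- The number of boxes `|c|`. -/
def length {n : ℕ} (c : Column n) : ℕ := c.entries.length

/-- The entry `cⁱ` of the `i`-th box; boxes are numbered from `1`, top to bottom. -/
def entry {n : ℕ} (c : Column n) : ℕ → Option (Fin n)
  | 0 => none
  | i + 1 => c.entries[i]?

/-- The column with the given entries, if they form one. -/
def ofList? {n : ℕ} (l : List (Fin n)) : Option (Column n) :=
  if h : IsColumn l then some ⟨l, h⟩ else none

end Column

/-- Strings of columns `c₁ |_{p₁} c₂ |_{p₂} … |_{pₘ} cₘ₊₁`, as the first column followed by the list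
`(p₁, c₂), …, (pₘ, cₘ₊₁)`. In `c |_p c'` the bottom box of `c'` is in the row number `p` of `c`, where
row `1` is the row of the top box of `c` (and `p` may be any integer). The empty column is identified
with the empty string. -/
inductive Scol (n : ℕ) : Type
  | empty : Scol n
  | mk (c : Column n) (l : List (ℤ × Column n)) : Scol n

namespace Scol

variable {n : ℕ}

/-- The string made of one column. -/
def single (c : Column n) : Scol n := mk c []

/-- The string of two columns `c |_p c'`. -/
def pair (c : Column n) (p : ℤ) (c' : Column n) : Scol n := mk c [(p, c')]

/-- The gluing `w |_p w'`; the empty string is neutral. -/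
def glue : Scol n → ℤ → Scol n → Scol n
  | empty, _, w' => w'
  | w, _, empty => w
  | mk c l, p, mk c' l' => mk c (l ++ (p, c') :: l')

/-- The columns of a string, from left to right. -/
def columns : Scol n → List (Column n)
  | empty => []
  | mk c l => c :: l.map Prod.snd

/-- The gluing sequence. -/
def gluings : Scol n → List ℤ
  | empty => []
  | mk _ l => l.map Prod.fst

/-- Glue a list of columns with respect to the gluing map `g`. -/
def ofColumns (g : Column n → Column n → ℤ) : List (Column n) → Scol n
  | [] => empty
  | c :: l => glue (single c) (match l with | [] => 0 | c' :: _ => g c c') (ofColumns g l)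

/-- Given the row `t` of the top box of `c`, the columns of `c |_{p₁} c₂ |_{p₂} …` together with the
rows of their top boxes. -/
def placeFrom : ℤ → Column n → List (ℤ × Column n) → List (ℤ × Column n)
  | t, c, [] => [(t, c)]
  | t, c, (p, c') :: l => (t, c) :: placeFrom (t + p - c'.length) c' l

/-- The columns of a string, each with the row of its top box; the top box of the first column is in
row `1`. -/
def placed : Scol n → List (ℤ × Column n)
  | empty => []
  | mk c l => placeFrom 1 c l

/-- The content of the box of the `k`-th column (from `0`) in row `h`; `none` for an empty box. -/
def box (w : Scol n) (k : ℕ) (h : ℤ) : Option (Fin n) :=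
  match w.placed[k]? with
  | none => none
  | some (t, c) => if t ≤ h then c.entries[(h - t).toNat]? else none

/-- Row connected: any two neighbouring columns share a full row, and no row has an empty box between
two nonempty boxes. -/
def IsRowConnected (w : Scol n) : Prop :=
  (∀ k, k + 1 < w.columns.length →
    ∃ h, (w.box k h).isSome = true ∧ (w.box (k + 1) h).isSome = true) ∧
  (∀ i j k h, i < j → j < k → (w.box i h).isSome = true → (w.box k h).isSome = true →
    (w.box j h).isSome = true)

/-- Row increasing: the entries weakly increase along every row. -/
def IsRowIncreasing (w : Scol n) : Prop :=
  ∀ i j h x y, i < j → w.box i h = some x → w.box j h = some y → x ≤ y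

/-- The set `Scolᶜ(n)` of row connected and row increasing strings of columns. -/
def IsScolc (w : Scol n) : Prop := w.IsRowConnected ∧ w.IsRowIncreasing

/-- Skew tableaux: strings in `Scolᶜ(n)` with `p_k ≤ |c_{k+1}|` for all `k`. -/
def IsSkew (w : Scol n) : Prop :=
  w.IsScolc ∧
    ∀ k p c', w.gluings[k]? = some p → w.columns[k + 1]? = some c' → p ≤ (c'.length : ℤ)

/-- Young tableaux: strings in `Scolᶜ(n)` with `p_k = |c_{k+1}|` (the columns are aligned at the top)
and with columns of weakly decreasing lengths. -/
def IsYoung (w : Scol n) : Prop :=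
  w.IsScolc ∧
    (∀ k p c', w.gluings[k]? = some p → w.columns[k + 1]? = some c' → p = (c'.length : ℤ)) ∧
    (∀ k c c', w.columns[k]? = some c → w.columns[k + 1]? = some c' → c'.length ≤ c.length)

end Scol

/-! ## String of columns rewriting systems -/

/-- A rewriting system: a set of rules `|_{p_s} u |_{q_s} ⇒ |_{p_t} v |_{q_t}`. -/
abbrev RewritingSystem (n : ℕ) : Type := ℤ × Scol n × ℤ → ℤ × Scol n × ℤ → Prop

section Rewriting

variable {n : ℕ}

/-- The rewrite relation: `w₁ |_{p_s} u |_{q_s} w₂ ⇒ w₁ |_{p_t} v |_{q_t} w₂` for a rule as above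
and strings `w₁`, `w₂`. -/
def Step (R : RewritingSystem n) (w w' : Scol n) : Prop :=
  ∃ (w₁ w₂ u v : Scol n) (ps qs pt qt : ℤ), R (ps, u, qs) (pt, v, qt) ∧
    w = w₁.glue ps (u.glue qs w₂) ∧ w' = w₁.glue pt (v.glue qt w₂)

/-- There is no infinite rewriting path. -/
def Terminating (R : RewritingSystem n) : Prop :=
  ¬ ∃ f : ℕ → Scol n, ∀ i, Step R (f i) (f (i + 1))

/-- Every branching of rewriting paths can be closed. -/
def Confluent (R : RewritingSystem n) : Prop :=
  ∀ w w₁ w₂, Relation.ReflTransGen (Step R) w w₁ → Relation.ReflTransGen (Step R) w w₂ →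
    ∃ w', Relation.ReflTransGen (Step R) w₁ w' ∧ Relation.ReflTransGen (Step R) w₂ w'

/-- Convergent: confluent and terminating. -/
def Convergent (R : RewritingSystem n) : Prop := Confluent R ∧ Terminating R

/-- `v` is a normal form of `w`: `w` rewrites to `v` and no rule reduces `v`. -/
def IsNormalFormOf (R : RewritingSystem n) (w v : Scol n) : Prop :=
  Relation.ReflTransGen (Step R) w v ∧ ∀ v', ¬ Step R v v'

open Classical in
/-- The normal form of `w` (meaningful when it exists and is unique, as for convergent systems). -/
noncomputable def nf (R : RewritingSystem n) (w : Scol n) : Scol n :=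
  if h : ∃ v, IsNormalFormOf R w v then h.choose else w

end Rewriting

/-! ## The rules of the jeu de taquin -/

section Rules

variable {n : ℕ}

/-- With `ci` and `cj` glued at position `k`, the entry `x = c_j^m` can be inserted in `ci` as its new
`l`-th entry: the box `c_j^m` is in the row above that of `c_i^l` (so that `c_i^l` is in a row with
`c_j^{m+1}`, or with an empty box when `m = |c_j|`), and `c_i^{l-1} < c_j^m < c_i^l`, where the first
inequality is void for `l = 1`. -/
def InsertsAt (ci cj : Column n) (k : ℤ) (l m : ℕ) (x : Fin n) : Prop :=
  (m : ℤ) = (l : ℤ) - 1 + cj.length - k ∧ cj.entry m = some x ∧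
    (∃ z, ci.entry l = some z ∧ x < z) ∧ (∀ y, ci.entry (l - 1) = some y → y < x)

/-- `InsertsAt` with `l` minimal. -/
def FirstInsertsAt (ci cj : Column n) (k : ℤ) (l m : ℕ) (x : Fin n) : Prop :=
  InsertsAt ci cj k l m x ∧ ∀ l' m' x', InsertsAt ci cj k l' m' x' → l ≤ l'

/-- `p` is the maximal position with `ci |_p cj` in `Scolᶜ(n)`, or `0` if there is none. -/
def IsMaxPosition (ci cj : Column n) (p : ℕ) : Prop :=
  (((Scol.pair ci p cj).IsScolc ∧ ∀ s : ℤ, (Scol.pair ci s cj).IsScolc → s ≤ p) ∨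
    (p = 0 ∧ ∀ s : ℤ, ¬ (Scol.pair ci s cj).IsScolc))

/-- The left-sliding rules. -/
inductive LS : RewritingSystem n
  /-- `α`: `cj` hangs below `ci`, and the entries of `cj` below the last row of `ci` slide to the
  left. -/
  | alpha (ci cj di dj : Column n) (p' q' : ℤ) (m : ℕ)
      (hm : ci.length ≤ m) (hm' : m < cj.length)
      (h : (Scol.pair ci ((ci.length : ℤ) + cj.length - m) cj).IsScolc)
      (hdi : di.entries = ci.entries ++ cj.entries.drop m)
      (hdj : dj.entries = cj.entries.take m) :
      LS (p', Scol.pair ci ((ci.length : ℤ) + cj.length - m) cj, q')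
        (p', Scol.pair di ci.length dj, q')
  /-- `δ^α`: `cj` slides up as little as possible, from the position at which `c_j^q` is in the last
  row of `ci` to one, in `Scolᶜ(n)`, at which `c_j^p` is; then the entries of `cj` below that row
  slide to the left. -/
  | deltaAlpha (ci cj di dj : Column n) (p' q' q : ℤ) (p : ℕ)
      (hs : ¬ (Scol.pair ci ((ci.length : ℤ) + cj.length - q) cj).IsScolc)
      (hp : ci.length ≤ p) (hp' : p < cj.length) (hqp : q < p)
      (ht : (Scol.pair ci ((ci.length : ℤ) + cj.length - p) cj).IsScolc)
      (hmin : ∀ r : ℕ, ci.length ≤ r →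
        (Scol.pair ci ((ci.length : ℤ) + cj.length - r) cj).IsScolc → p ≤ r)
      (hdi : di.entries = ci.entries ++ cj.entries.drop p)
      (hdj : dj.entries = cj.entries.take p) :
      LS (p', Scol.pair ci ((ci.length : ℤ) + cj.length - q) cj, q')
        (p', Scol.pair di ci.length dj, q' + (p - q))

/-- The insert-sliding rules. -/
inductive IS : RewritingSystem n
  /-- `β`: the entry `x = c_j^m` slides to the left into `ci`, as its new `l`-th entry. -/
  | beta (ci cj di dj : Column n) (p' q' : ℤ) (k l m : ℕ) (x : Fin n)
      (hk : 1 ≤ k) (hk' : k ≤ ci.length) (hk'' : k < cj.length)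
      (h : (Scol.pair ci k cj).IsScolc)
      (hl : FirstInsertsAt ci cj k l m x)
      (hdi : di.entries = ci.entries.take (l - 1) ++ x :: ci.entries.drop (l - 1))
      (hdj : dj.entries = cj.entries.eraseIdx (m - 1)) :
      IS (p', Scol.pair ci k cj, q') (p', Scol.pair di k dj, q')
  /-- `δ^β`: `cj` slides to the maximal position `p` (to the position `0`, just above `ci`, if there
  is none), where the entry `x = c_j^t` slides to the left into `ci`, as its new `l`-th entry. -/
  | deltaBeta (ci cj di dj : Column n) (p' q' q : ℤ) (p l t : ℕ) (x : Fin n)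
      (hs : ¬ (Scol.pair ci ((ci.length : ℤ) + cj.length - q) cj).IsScolc)
      (hp : IsMaxPosition ci cj p) (hp' : p ≤ ci.length) (hp'' : p < cj.length)
      (hup : (p : ℤ) < (ci.length : ℤ) + cj.length - q ∨ p = 0)
      (hl : FirstInsertsAt ci cj p l t x)
      (hdi : di.entries = ci.entries.take (l - 1) ++ x :: ci.entries.drop (l - 1))
      (hdj : dj.entries = cj.entries.eraseIdx (t - 1)) :
      IS (p', Scol.pair ci ((ci.length : ℤ) + cj.length - q) cj, q')
        (p', Scol.pair di p dj, q' + ((ci.length : ℤ) + cj.length - p - q))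
  /-- `δ^β` in the case where `cj` has only one box, so that no entry of `cj` is left. -/
  | deltaBetaOne (ci cj di : Column n) (p' q' q : ℤ) (p l t : ℕ) (x : Fin n)
      (hs : ¬ (Scol.pair ci ((ci.length : ℤ) + cj.length - q) cj).IsScolc)
      (hp : IsMaxPosition ci cj p) (hp' : p ≤ ci.length) (hp'' : p < cj.length)
      (hup : (p : ℤ) < (ci.length : ℤ) + cj.length - q ∨ p = 0)
      (hl : FirstInsertsAt ci cj p l t x)
      (hdi : di.entries = ci.entries.take (l - 1) ++ x :: ci.entries.drop (l - 1))
      (hdj : cj.entries.eraseIdx (t - 1) = []) :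
      IS (p', Scol.pair ci ((ci.length : ℤ) + cj.length - q) cj, q')
        (p', Scol.single di, q' + ((ci.length : ℤ) + cj.length - p - q))

/-- The top-sliding rules. -/
inductive TS : RewritingSystem n
  /-- `γ`: the left column `ci` slides up as much as possible, from position `r` to position `s`. -/
  | gamma (ci cj : Column n) (p' q' r s : ℤ)
      (h : ((Scol.pair ci r cj).IsScolc ∧ 1 ≤ r ∧ r < cj.length) ∨
        (¬ (Scol.pair ci r cj).IsRowConnected ∧
          ∃ a b, ci.entry 1 = some a ∧ cj.entry cj.length = some b ∧ a ≤ b))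
      (hs : (Scol.pair ci s cj).IsScolc) (hs' : s ≤ cj.length)
      (hmax : ∀ s' : ℤ, s' ≤ cj.length → (Scol.pair ci s' cj).IsScolc → s' ≤ s)
      (hrs : r < s) :
      TS (p', Scol.pair ci r cj, q') (p' - (s - r), Scol.pair ci s cj, q')
  /-- `δ`: the right column `cj`, whose top is below the top of `ci` (that is, `p < |c_i|`), slides up
  until the tops are aligned. -/
  | delta (ci cj : Column n) (p' q' p : ℤ) (hp : p < ci.length)
      (h : (¬ (Scol.pair ci ((ci.length : ℤ) + cj.length - p) cj).IsScolc ∧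
          (Scol.pair ci cj.length cj).IsScolc) ∨
        (Scol.pair ci ((ci.length : ℤ) + cj.length - p) cj).IsScolc ∨
        (¬ (Scol.pair ci ((ci.length : ℤ) + cj.length - p) cj).IsRowConnected ∧
          (ci.length : ℤ) < (ci.length : ℤ) + cj.length - p ∧
          ∃ a b, ci.entry ci.length = some a ∧ cj.entry 1 = some b ∧ a ≤ b)) :
      TS (p', Scol.pair ci ((ci.length : ℤ) + cj.length - p) cj, q')
        (p', Scol.pair ci cj.length cj, q' + ((ci.length : ℤ) - p))

/-- The rewriting system of the jeu de taquin: the union of the left-sliding, insert-sliding and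
top-sliding rules. -/
def FS (n : ℕ) : RewritingSystem n := fun a b => LS a b ∨ IS a b ∨ TS a b

end Rules

/-! ## Diagonal skew tableaux of words and Schensted's insertions -/

section Schensted

variable {n : ℕ}

/-- The diagonal skew tableau `[w]_s` of a word: `w` is cut into its maximal strictly decreasing
factors, each is the bottom to top reading of a column, and the columns are glued at position `1`. -/
def diagonal (w : List (Fin n)) : Scol n :=
  Scol.ofColumns (fun _ _ => 1)
    ((w.splitBy (fun a b => decide (b < a))).filterMap (fun f => Column.ofList? f.reverse))

/-- Insertion of `x` in a row or a column: `x` replaces the first entry `y` with `bumps x y`, which is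
returned, and is added at the end if there is none. -/
def bumpInsert (bumps : Fin n → Fin n → Bool) (x : Fin n) :
    List (Fin n) → List (Fin n) × Option (Fin n)
  | [] => ([x], none)
  | y :: r =>
    if bumps x y then (x :: r, some y)
    else (y :: (bumpInsert bumps x r).1, (bumpInsert bumps x r).2)

/-- Insertion of `x` in the first line, of the bumped entry in the second one, and so on, until no
entry is bumped. -/
def insertLines (bumps : Fin n → Fin n → Bool) : Fin n → List (List (Fin n)) → List (List (Fin n))
  | x, [] => [[x]]
  | x, r :: t =>
    match bumpInsert bumps x r with
    | (r', none) => r' :: t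
    | (r', some y) => r' :: insertLines bumps y t

/-- The columns of a tableau given by its rows, and conversely: the `j`-th line of the result collects
the `j`-th entries of the lines that have one. -/
def transposeLines (L : List (List (Fin n))) : List (List (Fin n)) :=
  (List.range ((L.map List.length).foldr max 0)).map (fun j => L.filterMap (fun r => r[j]?))

/-- The tableau with the given columns, aligned at the top. -/
def youngOfColumns (L : List (List (Fin n))) : Scol n :=
  Scol.ofColumns (fun _ c' => (c'.length : ℤ)) (L.filterMap Column.ofList?)

/-- Schensted's right insertion in a Young tableau: row insertion, where `x` bumps the smallest entry
`y` of the row with `x < y`. -/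
def rightInsert (t : Scol n) (x : Fin n) : Scol n :=
  youngOfColumns (transposeLines (insertLines (fun x y => decide (x < y)) x
    (transposeLines (t.columns.map Column.entries))))

/-- Schensted's left insertion in a Young tableau: column insertion, where `x` bumps the smallest entry
`y` of the column with `x ≤ y`. -/
def leftInsert (x : Fin n) (t : Scol n) : Scol n :=
  youngOfColumns (insertLines (fun x y => decide (x ≤ y)) x (t.columns.map Column.entries))

/-- The constructor of the right structure `Yrow`: the letters of `w` are inserted in the empty tableau
from the first one to the last one by the right insertion. -/
def constructorYrow (w : List (Fin n)) : Scol n := w.foldl rightInsert Scol.empty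

/-- The constructor of the left structure `Ycol`: the letters of `w` are inserted in the empty tableau
from the last one to the first one by the left insertion. -/
def constructorYcol (w : List (Fin n)) : Scol n := w.foldr leftInsert Scol.empty

end Schensted

end JeuDeTaquin

/-!
The proof rests on one invariant. The column reading of a string (columns from left to right, each from
bottom to top) does not depend on the gluing sequence, and every rule preserves its class in the
plactic monoid: the top-sliding rules do not change it (even when the rows are not increasing), and the
left-sliding and insert-sliding rules, where entries slide to the left from a position at which the rows
are increasing, are deduced from the Knuth relations (`RespectsKnuth.bottom_slide`,
`RespectsKnuth.insert_slide`). Instead of the plactic monoid itself, the arguments use an arbitrary map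
from letters to a monoid which satisfies the Knuth relations; it is applied to the action of the letters
on lists of columns by left insertion, for which a column acts as an automaton that turns Knuth
equivalent words into equal or Knuth equivalent words (`insertWord_knuth`).

A Young tableau is recovered from its column reading by left insertion (`insertAll_columnWord`). Hence
confluence does not require an analysis of the critical branchings: it is enough that every normal form
is a Young tableau. Indeed the positions of two columns `a`, `b` at which they form a string in
`Scolᶜ(n)` are `1, …, s` for some `s`, and a comparison of the given position with `s`, `|a|` and `|b|`
shows that a rule applies unless the pair is a Young tableau (`exists_rule`).

Termination: the left-sliding and insert-sliding rules move boxes to columns further to the left, and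
the top-sliding rules move the top of a column up, to the height of another top at most; the
lexicographic order on `leftWeight` and `heightDefect` decreases.

Finally, the left constructor computes the left insertion of the word by definition. For the right
constructor, the insertion of a letter in the rows multiplies the row reading on the right, and the row
reading of a tableau is equal to its column reading in the plactic monoid
(`RespectsKnuth.columnWord_eq_rowWord`).
-/

namespace JeuDeTaquin

/-! ### Knuth relations -/

section Knuth

variable {α : Type*} [LinearOrder α]

/-- The Knuth relations between words of three letters. -/
inductive Knuth : List α → List α → Prop
  | right (x y z : α) : x < y → y ≤ z → Knuth [y, z, x] [y, x, z]
  | left (x y z : α) : x ≤ y → y < z → Knuth [x, z, y] [z, x, y]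

variable {M : Type*} [Monoid M]

/-- `f` extends to a morphism from the plactic monoid: the product of the values of `f` along a word
does not change under the Knuth relations. -/
def RespectsKnuth (f : α → M) : Prop :=
  ∀ u v : List α, Knuth u v → (u.map f).prod = (v.map f).prod

/-- `Dominates R u v`: `v` is at most as long as `u`, and `R` holds between the entries of `u` and `v`
with the same index. -/
def Dominates {β γ : Type*} (R : β → γ → Prop) : List β → List γ → Prop
  | _, [] => True
  | [], _ :: _ => False
  | a :: u, b :: v => R a b ∧ Dominates R u v

/-- Adds the entries of `c` in front of the lines of `L`; `L` is completed by empty lines, and its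
lines beyond the length of `c` are dropped. -/
def consLines {β : Type*} : List β → List (List β) → List (List β)
  | [], _ => []
  | a :: c, [] => [a] :: consLines c []
  | a :: c, r :: L => (a :: r) :: consLines c L

/-- The word read along the lines, from the last one to the first one. -/
def rowWord {β : Type*} : List (List β) → List β
  | [] => []
  | r :: L => rowWord L ++ r

variable {f : α → M}

namespace RespectsKnuth

lemma right (hf : RespectsKnuth f) {x y z : α} (h : x < y) (h' : y ≤ z) :
    f y * (f z * f x) = f y * (f x * f z) := by
  simpa using hf _ _ (.right x y z h h')

lemma left (hf : RespectsKnuth f) {x y z : α} (h : x ≤ y) (h' : y < z) :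
    f x * (f z * f y) = f z * (f x * f y) := by
  simpa using hf _ _ (.left x y z h h')

/-- A letter `z` moves to the left through a column, up to the first entry of the column, if
this entry is at most `z`. -/
lemma letter_through_column (hf : RespectsKnuth f) {y z : α} {W : List α}
    (hW : (y :: W).Pairwise (· > ·)) (hz : y ≤ z) :
    f y * ((W.map f).prod * f z) = f y * (f z * (W.map f).prod) := by
  induction W generalizing y with
  | nil => simp
  | cons x W ih =>
    rw [List.pairwise_cons] at hW
    have hxy : x < y := hW.1 x (by simp)
    have h := ih hW.2 (hxy.le.trans hz)
    simp only [List.map_cons, List.prod_cons, mul_assoc] at h ⊢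
    rw [h, ← mul_assoc (f x), ← mul_assoc (f y), ← hf.right hxy hz]
    simp only [mul_assoc]

/-- A row moves to the left through a column, up to the first entry of the column. -/
lemma row_through_column (hf : RespectsKnuth f) {y : α} {W r : List α}
    (hW : (y :: W).Pairwise (· > ·)) (hr : (y :: r).Pairwise (· ≤ ·)) :
    f y * ((W.map f).prod * (r.map f).prod) = f y * ((r.map f).prod * (W.map f).prod) := by
  induction r generalizing y with
  | nil => simp
  | cons z r ih =>
    rw [List.pairwise_cons] at hr hW
    have hyz : y ≤ z := hr.1 z (by simp)
    have h1 := hf.letter_through_column (List.pairwise_cons.2 hW) hyz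
    have h2 := ih (y := z)
      (List.pairwise_cons.2 ⟨fun a ha => lt_of_lt_of_le (hW.1 a ha) hyz, hW.2⟩) hr.2
    simp only [List.map_cons, List.prod_cons, mul_assoc] at h2 ⊢
    rw [← h2, ← mul_assoc _ (f z), ← mul_assoc (f y), h1]
    simp only [mul_assoc]

/-- A column followed by the reading of rows to its right is the reading of the rows to which the
entries of the column are added. The column may be continued upwards by a column `W`. -/
lemma column_mul_rowWord (hf : RespectsKnuth f) {c W : List α} {L : List (List α)}
    (hc : c.Pairwise (· < ·)) (hW : W.Pairwise (· > ·)) (hcW : ∀ a ∈ c, ∀ x ∈ W, x < a)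
    (hL : Dominates (fun a r => (a :: r).Pairwise (· ≤ ·)) c L) :
    (c.reverse.map f).prod * ((W.map f).prod * ((rowWord L).map f).prod) =
      ((rowWord (consLines c L)).map f).prod * (W.map f).prod := by
  induction c generalizing W L with
  | nil =>
    cases L with
    | nil => simp [rowWord, consLines]
    | cons r L => exact hL.elim
  | cons a c ih =>
    rw [List.pairwise_cons] at hc
    have haW : (a :: W).Pairwise (· > ·) := List.pairwise_cons.2 ⟨hcW a (by simp), hW⟩
    have hcW' : ∀ b ∈ c, ∀ x ∈ a :: W, x < b := by
      intro b hb x hx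
      rcases List.mem_cons.1 hx with rfl | hx
      · exact hc.1 b hb
      · exact hcW b (by simp [hb]) x hx
    cases L with
    | nil =>
      have h := ih (L := []) hc.2 haW hcW' (by cases c <;> trivial)
      simp only [rowWord, consLines, List.reverse_cons, List.map_append, List.prod_append,
        List.map_cons, List.prod_cons, List.map_nil, List.prod_nil, mul_one, mul_assoc] at h ⊢
      exact h
    | cons r L =>
      have h := ih hc.2 haW hcW' hL.2
      have h' := hf.row_through_column haW hL.1
      simp only [rowWord, consLines, List.reverse_cons, List.map_append, List.prod_append,
        List.map_cons, List.prod_cons, List.map_nil, List.prod_nil, mul_one, mul_assoc] at h h' ⊢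
      have h := congrArg (· * (r.map f).prod) h
      simp only [mul_assoc] at h
      rw [h, h']

/-- A letter `a` passes through larger letters when a letter `b ≥ a` follows them. -/
lemma letter_through_larger (hf : RespectsKnuth f) {a b : α} {X : List α} (hab : a ≤ b)
    (hX : X.Pairwise (· > ·)) (hXb : ∀ x ∈ X, b < x) :
    f a * ((X.map f).prod * f b) = (X.map f).prod * (f a * f b) := by
  induction X with
  | nil => simp
  | cons x X ih =>
    rw [List.pairwise_cons] at hX
    have h := ih hX.2 (fun y hy => hXb y (by simp [hy]))
    cases X with
    | nil =>
      simp only [List.map_cons, List.prod_cons, List.map_nil, List.prod_nil, mul_one]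
      exact hf.left hab (hXb x (by simp))
    | cons x' X =>
      have h' := hf.left (z := x) (hab.trans (hXb x' (by simp)).le) (hX.1 x' (by simp))
      simp only [List.map_cons, List.prod_cons, mul_assoc] at h ⊢
      rw [← h, ← mul_assoc (f x), ← mul_assoc (f a), h']
      simp only [mul_assoc]

/-- The letters `X` of the right column which are below the left column `A` slide to the left, to the
bottom of `A`. The columns are read from bottom to top, and `B` is the part of the right column in the
rows of `A`. -/
lemma bottom_slide (hf : RespectsKnuth f) {A B X : List α} (hAB : List.Forall₂ (· ≤ ·) A B)
    (hX : (X ++ B).Pairwise (· > ·)) :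
    (A.map f).prod * ((X.map f).prod * (B.map f).prod) =
      (X.map f).prod * ((A.map f).prod * (B.map f).prod) := by
  induction hAB generalizing X with
  | nil => simp
  | @cons a b A B hab _ ih =>
    -- `b` first joins `X`, to pass through `A`; then `a` passes through `X`, with the help of `b`.
    have h1 := ih (X := X ++ [b]) (by simpa using hX)
    have h2 := ih (X := [b]) (List.pairwise_append.1 hX).2.1
    have h3 := hf.letter_through_larger hab (List.pairwise_append.1 hX).1
      (fun x hx => (List.pairwise_append.1 hX).2.2 x hx b (by simp))
    simp only [List.map_append, List.map_cons, List.prod_append, List.prod_cons, List.map_nil,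
      List.prod_nil, mul_one, mul_assoc] at h1 h2 ⊢
    rw [h1, h2, ← mul_assoc _ (f b), ← mul_assoc (f a), h3]
    simp only [mul_assoc]

lemma rowWord_map_singleton {β : Type*} (l : List β) :
    rowWord (l.map fun x => [x]) = l.reverse := by
  induction l with
  | nil => rfl
  | cons a l ih => simp [rowWord, ih]

/-- The letter `x` of the right column slides to the left between the parts `c` and `c'` of the left
column. The part `d'` of the right column below `x` is in the rows of `c'`; the entries of `d` are each
one row above the entries of `c`, and `e` is above `d`. -/
lemma insert_slide (hf : RespectsKnuth f) {c c' d d' e : List α} {x : α}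
    (hc : (c ++ x :: c').Pairwise (· < ·)) (hd : (e ++ d ++ x :: d').Pairwise (· < ·))
    (h : List.Forall₂ (· ≤ ·) c d) (h' : Dominates (· ≤ ·) c' d') :
    ((c ++ c').reverse.map f).prod * ((e ++ d ++ x :: d').reverse.map f).prod =
      ((c ++ x :: c').reverse.map f).prod * ((e ++ d ++ d').reverse.map f).prod := by
  have h'' : ∀ c' d' : List α, Dominates (· ≤ ·) c' d' →
      Dominates (fun a r => (a :: r).Pairwise (· ≤ ·)) c' (d'.map fun x => [x]) := by
    intro c' d'
    induction d' generalizing c' with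
    | nil => cases c' <;> simp [Dominates]
    | cons b d' ih =>
      cases c' with
      | nil => exact id
      | cons a c' => exact fun hh => ⟨by simpa using hh.1, ih _ hh.2⟩
  rw [List.pairwise_append] at hc
  have hcr : c.reverse.Pairwise (· > ·) := List.pairwise_reverse.2 hc.1
  have hxc := List.pairwise_cons.1 hc.2.1
  have h1 := hf.column_mul_rowWord hxc.2 hcr
    (fun a ha y hy => hc.2.2 y (by simpa using hy) a (by simp [ha])) (h'' _ _ h')
  have h2 := hf.column_mul_rowWord hxc.2 (W := x :: c.reverse)
    (List.pairwise_cons.2 ⟨fun a ha => hc.2.2 a (by simpa using ha) x (by simp), hcr⟩)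
    (fun a ha y hy => by
      rcases List.mem_cons.1 hy with rfl | hy
      · exact hxc.1 a ha
      · exact hc.2.2 y (by simpa using hy) a (by simp [ha])) (h'' _ _ h')
  have h3 := hf.bottom_slide (A := c.reverse) (B := d.reverse) (X := [x])
    (List.rel_reverse h) (by
      have : (d ++ [x]).reverse.Pairwise (· > ·) := List.pairwise_reverse.2
        (hd.sublist (by
          rw [List.append_assoc]
          exact (((List.nil_sublist d').cons_cons x).append_left d).trans
            (List.sublist_append_right e _)))
      simpa using this)
  rw [rowWord_map_singleton] at h1 h2
  simp only [List.reverse_append, List.reverse_cons, List.map_append, List.map_cons,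
    List.prod_append, List.prod_cons, List.map_nil, List.prod_nil, mul_one, mul_assoc]
    at h1 h2 h3 ⊢
  have h1 := congrArg (· * (f x * ((d.reverse.map f).prod * (e.reverse.map f).prod))) h1
  have h2 := congrArg (· * ((d.reverse.map f).prod * (e.reverse.map f).prod)) h2
  have h3 := congrArg (· * (e.reverse.map f).prod) h3
  simp only [mul_assoc] at h1 h2 h3
  rw [h1, h2, h3]

end RespectsKnuth

end Knuth

/-! ### Column insertion satisfies the Knuth relations -/

section ColumnInsertion

variable {n : ℕ}

/-- The bumping condition of the column insertion. -/
abbrev colBumps (x y : Fin n) : Bool := decide (x ≤ y)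

lemma bumpInsert_fst_ne_nil (bumps : Fin n → Fin n → Bool) (x : Fin n) (c : List (Fin n)) :
    (bumpInsert bumps x c).1 ≠ [] := by
  cases c with
  | nil => simp [bumpInsert]
  | cons h c => by_cases hx : bumps x h <;> simp [bumpInsert, hx]

lemma mem_bumpInsert (bumps : Fin n → Fin n → Bool) (x a : Fin n) (c : List (Fin n))
    (h : a ∈ (bumpInsert bumps x c).1) : a = x ∨ a ∈ c := by
  induction c with
  | nil => simpa [bumpInsert] using h
  | cons b c ih =>
    by_cases hx : bumps x b
    · simp only [bumpInsert, hx, if_true, List.mem_cons] at h ⊢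
      tauto
    · simp only [bumpInsert, hx, Bool.false_eq_true, if_false, List.mem_cons] at h ⊢
      tauto

lemma mem_of_bumpInsert_snd {bumps : Fin n → Fin n → Bool} {x a : Fin n} {c : List (Fin n)}
    (h : (bumpInsert bumps x c).2 = some a) : a ∈ c ∧ bumps x a := by
  induction c with
  | nil => simp [bumpInsert] at h
  | cons b c ih =>
    by_cases hx : bumps x b
    · simp only [bumpInsert, hx, if_true, Option.some.injEq] at h
      subst h
      simp [hx]
    · simp only [bumpInsert, hx, Bool.false_eq_true, if_false] at h
      simp [ih h]

lemma pairwise_bumpInsert_col {x : Fin n} {c : List (Fin n)} (hc : c.Pairwise (· < ·)) :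
    (bumpInsert colBumps x c).1.Pairwise (· < ·) := by
  induction c with
  | nil => simp [bumpInsert]
  | cons b c ih =>
    rw [List.pairwise_cons] at hc
    by_cases hx : x ≤ b
    · simp only [bumpInsert, colBumps, hx, decide_true, if_true, List.pairwise_cons]
      exact ⟨fun a ha => lt_of_le_of_lt hx (hc.1 a ha), hc.2⟩
    · simp only [bumpInsert, colBumps, hx, decide_false, Bool.false_eq_true, if_false,
        List.pairwise_cons]
      refine ⟨fun a ha => ?_, ih hc.2⟩
      rcases mem_bumpInsert _ _ _ _ ha with rfl | ha
      · exact not_le.1 hx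
      · exact hc.1 a ha

/-- After the insertion of `z` in a column, the insertion of a letter `y ≤ z` bumps a letter `≤ z`. -/
lemma bumpInsert_col_of_le {y z : Fin n} (c : List (Fin n)) (h : y ≤ z) :
    ∃ a, (bumpInsert colBumps y (bumpInsert colBumps z c).1).2 = some a ∧ a ≤ z := by
  induction c with
  | nil => exact ⟨z, by simp [bumpInsert, h]⟩
  | cons b c ih =>
    by_cases hz : z ≤ b
    · exact ⟨z, by simp [bumpInsert, hz, h]⟩
    · by_cases hy : y ≤ b
      · exact ⟨b, by simp [bumpInsert, hz, hy, (not_le.1 hz).le]⟩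
      · simpa [bumpInsert, hz, hy] using ih

/-- If `z > y` bumps a letter from a column where `y` has been inserted, then `y` has bumped a smaller
letter. -/
lemma bumpInsert_col_of_lt {y z a : Fin n} {c : List (Fin n)} (hc : c.Pairwise (· < ·)) (h : y < z)
    (ha : (bumpInsert colBumps z (bumpInsert colBumps y c).1).2 = some a) :
    ∃ b, (bumpInsert colBumps y c).2 = some b ∧ b < a := by
  induction c with
  | nil => simp [bumpInsert, not_le.2 h] at ha
  | cons b c ih =>
    rw [List.pairwise_cons] at hc
    by_cases hy : y ≤ b
    · simp only [bumpInsert, colBumps, hy, decide_true, if_true, not_le.2 h, decide_false,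
        Bool.false_eq_true, if_false] at ha ⊢
      exact ⟨b, rfl, hc.1 a (mem_of_bumpInsert_snd ha).1⟩
    · have hz : ¬ z ≤ b := fun hz => hy (h.le.trans hz)
      simp only [bumpInsert, colBumps, hy, hz, decide_false, Bool.false_eq_true, if_false] at ha ⊢
      exact ih hc.2 ha

/-- Inserts the letters of a word in a column from right to left: the column obtained, and the
word of bumped letters, which are to be inserted from right to left in the next column. -/
def insertWord : List (Fin n) → List (Fin n) → List (Fin n) × List (Fin n)
  | [], c => (c, [])
  | x :: u, c => ((bumpInsert colBumps x (insertWord u c).1).1,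
      (bumpInsert colBumps x (insertWord u c).1).2.toList ++ (insertWord u c).2)

/-- Knuth equivalent words of three letters modify a column in the same way, and the words of bumped
letters are equal or Knuth equivalent. -/
lemma insertWord_knuth {u v : List (Fin n)} (h : Knuth u v) {c : List (Fin n)}
    (hc : c.Pairwise (· < ·)) :
    (insertWord u c).1 = (insertWord v c).1 ∧
      ((insertWord u c).2 = (insertWord v c).2 ∨ Knuth (insertWord u c).2 (insertWord v c).2) := by
  obtain ⟨x, y, z, hxy, hyz⟩ | ⟨x, y, z, hxy, hyz⟩ := h
  · have hxz : x < z := lt_of_lt_of_le hxy hyz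
    induction c with
    | nil => simp [insertWord, bumpInsert, hyz, not_le.2 hxy, not_le.2 hxz, hxz.le]
    | cons b c ih =>
      rw [List.pairwise_cons] at hc
      by_cases hx : x ≤ b
      · by_cases hz : z ≤ b
        · cases c with
          | nil => simp [insertWord, bumpInsert, hyz, not_le.2 hxy, not_le.2 hxz, hxz.le, hx, hz]
          | cons d c =>
            have hbd : b < d := hc.1 d (by simp)
            have hzd : z ≤ d := hz.trans hbd.le
            have hyd : y ≤ d := hyz.trans hzd
            simp only [insertWord, bumpInsert, colBumps, hyz, not_le.2 hxy, not_le.2 hxz, hxz.le, hx,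
              hz, hzd, hyd, decide_true, if_true, decide_false, Bool.false_eq_true, if_false]
            exact ⟨trivial, Or.inr (.left z b d hz hbd)⟩
        · obtain ⟨a, ha, haz⟩ := bumpInsert_col_of_le c hyz
          simp only [insertWord, bumpInsert, colBumps, not_le.2 hxy, not_le.2 hxz, hx, hz,
            decide_true, if_true, decide_false, Bool.false_eq_true, if_false, ha, true_and]
          cases ho : (bumpInsert colBumps z c).2 with
          | none => simp
          | some o =>
            obtain ⟨-, ho2⟩ := mem_of_bumpInsert_snd ho
            obtain ⟨ha1, -⟩ := mem_of_bumpInsert_snd ha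
            have hba : b < a := by
              rcases mem_bumpInsert _ _ _ _ ha1 with rfl | h
              · exact not_le.1 hz
              · exact hc.1 a h
            exact Or.inr (.right b a o hba (haz.trans (by simpa using ho2)))
      · have hx' := not_le.1 hx
        simpa only [insertWord, bumpInsert, colBumps, hx, not_le.2 (hx'.trans hxy),
          not_le.2 (hx'.trans hxz), decide_false, Bool.false_eq_true, if_false,
          List.cons.injEq, true_and] using ih hc.2
  · have hxz : x < z := lt_of_le_of_lt hxy hyz
    induction c with
    | nil => simp [insertWord, bumpInsert, hxy, not_le.2 hyz, not_le.2 hxz]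
    | cons b c ih =>
      rw [List.pairwise_cons] at hc
      by_cases hx : x ≤ b
      · by_cases hy : y ≤ b
        · simp only [insertWord, bumpInsert, colBumps, hxy, not_le.2 hyz, not_le.2 hxz, hy,
            decide_true, if_true, decide_false, Bool.false_eq_true, if_false, true_and]
          cases ho : (bumpInsert colBumps z c).2 with
          | none => simp
          | some o => exact Or.inr (.left y b o hy (hc.1 o (mem_of_bumpInsert_snd ho).1))
        · have hy' := not_le.1 hy
          simp only [insertWord, bumpInsert, colBumps, not_le.2 hxz, hx, hy,
            not_le.2 (hy'.trans hyz), decide_true, if_true, decide_false, Bool.false_eq_true,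
            if_false, true_and]
          cases ho : (bumpInsert colBumps z (bumpInsert colBumps y c).1).2 with
          | none => simp
          | some o =>
            obtain ⟨a, ha, hao⟩ := bumpInsert_col_of_lt hc.2 hyz ho
            rw [ha]
            exact Or.inr (.left b a o (hc.1 a (mem_of_bumpInsert_snd ha).1).le hao)
      · have hx' := not_le.1 hx
        simpa only [insertWord, bumpInsert, colBumps, hx, not_le.2 (hx'.trans_le hxy),
          not_le.2 (hx'.trans hxz), decide_false, Bool.false_eq_true, if_false,
          List.cons.injEq, true_and] using ih hc.2

/-- Insertion of the letters of a word, from right to left, in a tableau given by its columns. -/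
def insertAll (u : List (Fin n)) (L : List (List (Fin n))) : List (List (Fin n)) :=
  u.foldr (insertLines colBumps) L

lemma insertAll_cons (u c : List (Fin n)) (L : List (List (Fin n))) :
    insertAll u (c :: L) = (insertWord u c).1 :: insertAll (insertWord u c).2 L := by
  induction u with
  | nil => rfl
  | cons x u ih =>
    change insertLines colBumps x (insertAll u (c :: L)) = _
    rw [ih]
    cases h : bumpInsert colBumps x (insertWord u c).1 with
    | mk c' o => cases o <;> simp [insertWord, insertLines, h, insertAll]

lemma insertAll_knuth {u v : List (Fin n)} (h : Knuth u v) {L : List (List (Fin n))}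
    (hL : ∀ c ∈ L, c.Pairwise (· < ·)) : insertAll u L = insertAll v L := by
  induction L generalizing u v with
  | nil =>
    obtain ⟨x, y, z, hxy, hyz⟩ | ⟨x, y, z, hxy, hyz⟩ := h
    · have hxz : x < z := lt_of_lt_of_le hxy hyz
      simp [insertAll, insertLines, bumpInsert, hyz, not_le.2 hxy, not_le.2 hxz, hxz.le]
    · have hxz : x < z := lt_of_le_of_lt hxy hyz
      simp [insertAll, insertLines, bumpInsert, hxy, not_le.2 hyz, not_le.2 hxz]
  | cons c L ih =>
    obtain ⟨h1, h2⟩ := insertWord_knuth h (hL c (by simp))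
    rw [insertAll_cons, insertAll_cons, h1]
    rcases h2 with h2 | h2
    · rw [h2]
    · rw [ih h2 fun d hd => hL d (by simp [hd])]

lemma isColumn_insertLines (x : Fin n) {L : List (List (Fin n))} (hL : ∀ c ∈ L, IsColumn c) :
    ∀ c ∈ insertLines colBumps x L, IsColumn c := by
  induction L generalizing x with
  | nil => simp [insertLines, IsColumn]
  | cons d L ih =>
    have hd : IsColumn (bumpInsert colBumps x d).1 :=
      ⟨bumpInsert_fst_ne_nil _ _ _, pairwise_bumpInsert_col (hL d (by simp)).2⟩
    have hL' : ∀ c ∈ L, IsColumn c := fun c hc => hL c (by simp [hc])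
    cases h : bumpInsert colBumps x d with
    | mk d' o =>
      rw [h] at hd
      intro c hc
      cases o <;> simp only [insertLines, h, List.mem_cons] at hc
      · rcases hc with rfl | hc
        · exact hd
        · exact hL' c hc
      · rcases hc with rfl | hc
        · exact hd
        · exact ih _ hL' c hc

lemma isColumn_insertAll (u : List (Fin n)) {L : List (List (Fin n))} (hL : ∀ c ∈ L, IsColumn c) :
    ∀ c ∈ insertAll u L, IsColumn c := by
  induction u with
  | nil => exact hL
  | cons x u ih => exact isColumn_insertLines x ih

/-- Lists of (contents of) columns. -/
abbrev ColumnList (n : ℕ) : Type := {L : List (List (Fin n)) // ∀ c ∈ L, IsColumn c}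

/-- The action of the letters on lists of columns by left insertion. -/
def leftAction (x : Fin n) : Function.End (ColumnList n) :=
  fun L => ⟨insertLines colBumps x L.1, isColumn_insertLines x L.2⟩

lemma leftAction_prod (u : List (Fin n)) (L : ColumnList n) :
    ((u.map leftAction).prod L).1 = insertAll u L.1 := by
  induction u with
  | nil => rfl
  | cons x u ih =>
    rw [List.map_cons, List.prod_cons]
    change insertLines colBumps x ((u.map leftAction).prod L).1 = _
    rw [ih]
    rfl

lemma leftAction_respectsKnuth : RespectsKnuth (leftAction (n := n)) := by
  intro u v h
  funext L
  apply Subtype.ext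
  rw [leftAction_prod, leftAction_prod]
  exact insertAll_knuth h fun c hc => (L.2 c hc).2

/-! ### Tableaux as lists of lines -/

/-- The lines of a tableau: they are nonempty, the entries increase for `S` along a line, the lengths
of the lines decrease, and the entries increase for `R` from each line to the next one. The columns of a
Young tableau form a tableau for `(≤, <)`, and its rows one for `(<, ≤)`. -/
def IsTableau {α : Type*} (R S : α → α → Prop) : List (List α) → Prop
  | [] => True
  | c :: L => c ≠ [] ∧ c.Pairwise S ∧ (∀ d ∈ L.head?, Dominates R c d) ∧ IsTableau R S L

/-- The word read along the columns, each from bottom to top. -/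
def columnWord {α : Type*} (L : List (List α)) : List α := L.flatMap List.reverse

lemma insertWord_append (u v c : List (Fin n)) :
    insertWord (u ++ v) c = ((insertWord u (insertWord v c).1).1,
      (insertWord u (insertWord v c).1).2 ++ (insertWord v c).2) := by
  induction u with
  | nil => simp [insertWord]
  | cons x u ih => simp [insertWord, ih]

lemma insertWord_column_cons {a : Fin n} {u : List (Fin n)} (hu : ∀ x ∈ u, a < x)
    (c : List (Fin n)) : insertWord u (a :: c) = (a :: (insertWord u c).1, (insertWord u c).2) := by
  induction u with
  | nil => rfl
  | cons x u ih =>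
    have hx : ¬ x ≤ a := not_le.2 (hu x (by simp))
    simp [insertWord, ih fun y hy => hu y (by simp [hy]), bumpInsert, hx]

/-- The reading of a column, when inserted in a column which it dominates, replaces it. -/
lemma insertWord_reverse {c d : List (Fin n)} (hc : c.Pairwise (· < ·))
    (hcd : Dominates (· ≤ ·) c d) : insertWord c.reverse d = (c, d.reverse) := by
  induction c generalizing d with
  | nil =>
    cases d with
    | nil => rfl
    | cons b d => exact hcd.elim
  | cons a c ih =>
    rw [List.pairwise_cons] at hc
    have ha : ∀ x ∈ c.reverse, a < x := fun x hx => hc.1 x (by simpa using hx)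
    rw [List.reverse_cons, insertWord_append]
    cases d with
    | nil =>
      simp [insertWord, bumpInsert, insertWord_column_cons ha, ih (d := []) hc.2 (by cases c <;> trivial)]
    | cons b d =>
      have hab : a ≤ b := hcd.1
      simp [insertWord, bumpInsert, hab, insertWord_column_cons ha, ih hc.2 hcd.2]

lemma insertAll_append (u v : List (Fin n)) (L : List (List (Fin n))) :
    insertAll (u ++ v) L = insertAll u (insertAll v L) := by
  simp [insertAll]

/-- The insertion of the first column of a tableau in the tableau formed by the other ones. -/
lemma insertAll_reverse {c : List (Fin n)} {L : List (List (Fin n))}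
    (hL : IsTableau (· ≤ ·) (· < ·) (c :: L)) : insertAll c.reverse L = c :: L := by
  induction L generalizing c with
  | nil =>
    obtain ⟨h1, h2, -, -⟩ := hL
    obtain ⟨x, u, hu⟩ : ∃ x u, c.reverse = u ++ [x] :=
      ⟨c.head h1, c.tail.reverse, by rw [← List.reverse_cons, List.cons_head_tail]⟩
    have h : insertAll c.reverse [] = insertAll c.reverse [[]] := by
      rw [hu, insertAll_append, insertAll_append]
      rfl
    rw [h, insertAll_cons, insertWord_reverse h2 (by cases c <;> trivial)]
    rfl
  | cons d L ih =>
    obtain ⟨-, h2, h3, h4⟩ := hL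
    rw [insertAll_cons, insertWord_reverse h2 (h3 d rfl)]
    exact congrArg (c :: ·) (ih h4)

/-- A tableau is obtained by inserting its reading word. -/
lemma insertAll_columnWord {L : List (List (Fin n))} (hL : IsTableau (· ≤ ·) (· < ·) L) :
    insertAll (columnWord L) [] = L := by
  induction L with
  | nil => rfl
  | cons c L ih =>
    rw [columnWord, List.flatMap_cons, insertAll_append]
    change insertAll c.reverse (insertAll (columnWord L) []) = _
    rw [ih hL.2.2.2, insertAll_reverse hL]

end ColumnInsertion

/-! ### Transposition of tableaux -/

section Transposition

variable {α : Type*}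

/-- The transposed tableau: the entries of the first line are added in front of the lines of the
transposed tableau of the remaining lines. -/
def transpose (L : List (List α)) : List (List α) := L.foldr consLines []

lemma Dominates.length_le {β γ : Type*} {R : β → γ → Prop} {u : List β} {v : List γ}
    (h : Dominates R u v) : v.length ≤ u.length := by
  induction u generalizing v with
  | nil =>
    cases v with
    | nil => rfl
    | cons b v => exact h.elim
  | cons a u ih =>
    cases v with
    | nil => simp
    | cons b v => simpa using ih h.2

lemma Dominates.nil_right {β γ : Type*} (R : β → γ → Prop) (u : List β) : Dominates R u [] := by
  cases u <;> trivial

lemma dominates_iff {β γ : Type*} {R : β → γ → Prop} {u : List β} {v : List γ} :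
    Dominates R u v ↔ v.length ≤ u.length ∧
      ∀ (i : ℕ) x y, u[i]? = some x → v[i]? = some y → R x y := by
  induction u generalizing v with
  | nil =>
    cases v with
    | nil => simp [Dominates]
    | cons b v => simp [Dominates]
  | cons a u ih =>
    cases v with
    | nil => simp [Dominates]
    | cons b v =>
      rw [Dominates, ih]
      constructor
      · rintro ⟨h1, h2, h3⟩
        refine ⟨by simpa using h2, fun i x y hx hy => ?_⟩
        cases i with
        | zero => simp at hx hy; subst hx hy; exact h1
        | succ i => exact h3 i x y (by simpa using hx) (by simpa using hy)
      · rintro ⟨h2, h3⟩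
        exact ⟨h3 0 a b rfl rfl, by simpa using h2,
          fun i x y hx hy => h3 (i + 1) x y (by simpa using hx) (by simpa using hy)⟩

lemma length_consLines (c : List α) (L : List (List α)) : (consLines c L).length = c.length := by
  induction c generalizing L with
  | nil => rfl
  | cons a c ih => cases L <;> simp [consLines, ih]

lemma getElem?_consLines (u : List α) (L : List (List α)) (j : ℕ) :
    (consLines u L)[j]? = u[j]?.map (fun a => a :: L[j]?.getD []) := by
  induction u generalizing L j with
  | nil => rfl
  | cons a u ih => cases L <;> cases j <;> simp [consLines, ih]

lemma transpose_consLines {c : List α} {L : List (List α)}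
    (hL : ∀ l ∈ L, l ≠ []) (h : L.length ≤ c.length) :
    transpose (consLines c L) = if c = [] then [] else c :: transpose L := by
  induction c generalizing L with
  | nil => rfl
  | cons a c ih =>
    cases L with
    | nil =>
      have h := ih (L := []) (by simp) (by simp)
      simp only [transpose, consLines, List.foldr_cons] at h ⊢
      rw [h, if_neg (List.cons_ne_nil _ _)]
      split_ifs with hc <;> simp [hc, consLines]
    | cons r L =>
      have h1 := ih (L := L) (fun l hl => hL l (by simp [hl])) (by simpa using h)
      obtain ⟨b, r, rfl⟩ := List.exists_cons_of_ne_nil (hL r (by simp))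
      simp only [transpose, consLines, List.foldr_cons] at h1 ⊢
      rw [h1, if_neg (List.cons_ne_nil _ _)]
      split_ifs with hc
      · subst hc
        obtain rfl : L = [] := by simpa using h
        simp [consLines]
      · simp [consLines]

lemma IsTableau.length_transpose_le {R S : α → α → Prop} {c : List α} {L : List (List α)}
    (h : IsTableau R S (c :: L)) : (transpose L).length ≤ c.length := by
  cases L with
  | nil => simp [transpose]
  | cons d L =>
    rw [transpose, List.foldr_cons, length_consLines]
    exact (h.2.2.1 d rfl).length_le

/-- If a line dominates the next one, it can be added as the first entries of the transposed
tableau. -/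
lemma dominates_consLines {R : α → α → Prop} [IsTrans α R] {c d : List α} {L : List (List α)}
    (h : Dominates R c d) (hL : ∀ l ∈ consLines d L, l.Pairwise R) :
    Dominates (fun a r => (a :: r).Pairwise R) c (consLines d L) := by
  induction c generalizing d L with
  | nil =>
    cases d with
    | nil => trivial
    | cons b d => exact h.elim
  | cons a c ih =>
    cases d with
    | nil => trivial
    | cons b d =>
      have key : ∀ r : List α, (b :: r).Pairwise R → (a :: b :: r).Pairwise R := fun r hr =>
        List.pairwise_cons.2 ⟨fun x hx => by
          rcases List.mem_cons.1 hx with rfl | hx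
          · exact h.1
          · exact _root_.trans h.1 ((List.pairwise_cons.1 hr).1 x hx), hr⟩
      cases L with
      | nil => exact ⟨key _ (hL _ (by simp [consLines])),
          ih h.2 fun l hl => hL l (by simp [consLines, hl])⟩
      | cons r L => exact ⟨key _ (hL _ (by simp [consLines])),
          ih h.2 fun l hl => hL l (by simp [consLines, hl])⟩

lemma isTableau_consLines {R S : α → α → Prop} {c : List α} {L : List (List α)}
    (hc : c.Pairwise S) (hL : IsTableau S R L)
    (h : Dominates (fun a r => (a :: r).Pairwise R) c L) : IsTableau S R (consLines c L) := by
  induction c generalizing L with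
  | nil => trivial
  | cons a c ih =>
    rw [List.pairwise_cons] at hc
    cases L with
    | nil =>
      refine ⟨by simp, by simp, fun d hd => ?_, ih hc.2 trivial (.nil_right _ _)⟩
      cases c with
      | nil => simp [consLines] at hd
      | cons b c =>
        simp [consLines] at hd
        subst hd
        exact ⟨hc.1 b (by simp), trivial⟩
    | cons r L =>
      refine ⟨by simp, h.1, fun d hd => ?_, ih hc.2 hL.2.2.2 h.2⟩
      cases c with
      | nil => simp [consLines] at hd
      | cons b c =>
        have hab : S a b := hc.1 b (by simp)
        cases L with
        | nil =>
          simp [consLines] at hd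
          subst hd
          exact ⟨hab, .nil_right _ _⟩
        | cons s L =>
          simp [consLines] at hd
          subst hd
          exact ⟨hab, hL.2.2.1 s rfl⟩

lemma IsTableau.pairwise {R S : α → α → Prop} {L : List (List α)} (h : IsTableau R S L) :
    ∀ l ∈ L, l.Pairwise S := by
  induction L with
  | nil => simp
  | cons c L ih =>
    intro l hl
    rcases List.mem_cons.1 hl with rfl | hl
    · exact h.2.1
    · exact ih h.2.2.2 l hl

lemma IsTableau.ne_nil {R S : α → α → Prop} {L : List (List α)} (h : IsTableau R S L) :
    ∀ l ∈ L, l ≠ [] := by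
  induction L with
  | nil => simp
  | cons c L ih =>
    intro l hl
    rcases List.mem_cons.1 hl with rfl | hl
    · exact h.1
    · exact ih h.2.2.2 l hl

lemma IsTableau.dominates_transpose {R S : α → α → Prop} [IsTrans α R] {c : List α}
    {L : List (List α)} (h : IsTableau R S (c :: L)) (hL : IsTableau S R (transpose L)) :
    Dominates (fun a r => (a :: r).Pairwise R) c (transpose L) := by
  cases L with
  | nil => exact .nil_right _ _
  | cons d L => exact dominates_consLines (h.2.2.1 d rfl) hL.pairwise

lemma IsTableau.transpose {R S : α → α → Prop} [IsTrans α R] {L : List (List α)}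
    (h : IsTableau R S L) : IsTableau S R (transpose L) := by
  induction L with
  | nil => trivial
  | cons c L ih =>
    have hL := ih h.2.2.2
    exact isTableau_consLines h.2.1 hL (h.dominates_transpose hL)

lemma IsTableau.transpose_transpose {R S : α → α → Prop} [IsTrans α R] {L : List (List α)}
    (h : IsTableau R S L) : JeuDeTaquin.transpose (JeuDeTaquin.transpose L) = L := by
  induction L with
  | nil => rfl
  | cons c L ih =>
    change JeuDeTaquin.transpose (consLines c (JeuDeTaquin.transpose L)) = _
    rw [transpose_consLines h.2.2.2.transpose.ne_nil h.length_transpose_le, if_neg h.1, ih h.2.2.2]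

lemma IsTableau.foldr_max_length {R S : α → α → Prop} {L : List (List α)} (h : IsTableau R S L) :
    (L.map List.length).foldr max 0 = (L.headD []).length := by
  induction L with
  | nil => rfl
  | cons c L ih =>
    rw [List.map_cons, List.foldr_cons, ih h.2.2.2]
    cases L with
    | nil => simp
    | cons d L => exact max_eq_left (h.2.2.1 d rfl).length_le

lemma filterMap_getElem?_eq_nil (L : List (List α)) {j : ℕ}
    (h : (L.map List.length).foldr max 0 ≤ j) : L.filterMap (fun r => r[j]?) = [] := by
  induction L with
  | nil => rfl
  | cons c L ih =>
    rw [List.map_cons, List.foldr_cons, max_le_iff] at h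
    rw [List.filterMap_cons, List.getElem?_eq_none h.1, ih h.2]

end Transposition

lemma transposeLines_eq_transpose {n : ℕ} {R S : Fin n → Fin n → Prop} {L : List (List (Fin n))}
    (h : IsTableau R S L) : transposeLines L = transpose L := by
  induction L with
  | nil => rfl
  | cons c L ih =>
    have key : ∀ j : ℕ, (transpose L)[j]?.getD [] = L.filterMap (fun r => r[j]?) := by
      intro j
      rw [← ih h.2.2.2, transposeLines, List.getElem?_map]
      by_cases hj : j < (L.map List.length).foldr max 0
      · rw [List.getElem?_range hj]
        rfl
      · rw [filterMap_getElem?_eq_nil L (not_lt.1 hj), List.getElem?_eq_none (by simpa using hj)]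
        rfl
    apply List.ext_getElem?
    intro j
    change _ = (consLines c (transpose L))[j]?
    rw [getElem?_consLines, key, transposeLines, h.foldr_max_length, List.getElem?_map]
    by_cases hj : j < c.length
    · simp [hj]
    · simp [hj]

/-! ### Row insertion -/

section RowInsertion

variable {n : ℕ}

/-- The bumping condition of the row insertion. -/
abbrev rowBumps (x y : Fin n) : Bool := decide (x < y)

lemma head_bumpInsert_row {x y h : Fin n} {r t : List (Fin n)}
    (hr : bumpInsert rowBumps x r = (h :: t, some y)) : h < y := by
  cases r with
  | nil => simp [bumpInsert] at hr
  | cons b r =>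
    by_cases hx : x < b
    · simp only [bumpInsert, rowBumps, hx, decide_true, if_true, Prod.mk.injEq, List.cons.injEq,
        Option.some.injEq] at hr
      rw [← hr.1.1, ← hr.2]
      exact hx
    · simp only [bumpInsert, rowBumps, hx, decide_false, Bool.false_eq_true, if_false, Prod.mk.injEq,
        List.cons.injEq] at hr
      have h2 : x < y := by simpa using (mem_of_bumpInsert_snd hr.2).2
      rw [← hr.1.1]
      exact lt_of_le_of_lt (not_lt.1 hx) h2

lemma pairwise_bumpInsert_row {x : Fin n} {r : List (Fin n)} (hr : r.Pairwise (· ≤ ·)) :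
    (bumpInsert rowBumps x r).1.Pairwise (· ≤ ·) := by
  induction r with
  | nil => simp [bumpInsert]
  | cons b r ih =>
    rw [List.pairwise_cons] at hr
    by_cases hx : x < b
    · simp only [bumpInsert, rowBumps, hx, decide_true, if_true, List.pairwise_cons]
      exact ⟨fun a ha => hx.le.trans (hr.1 a ha), hr.2⟩
    · simp only [bumpInsert, rowBumps, hx, decide_false, Bool.false_eq_true, if_false,
        List.pairwise_cons]
      refine ⟨fun a ha => ?_, ih hr.2⟩
      rcases mem_bumpInsert _ _ _ _ ha with rfl | ha
      · exact not_lt.1 hx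
      · exact hr.1 a ha

lemma dominates_bumpInsert_left {x : Fin n} {r s : List (Fin n)} (h : Dominates (· < ·) r s) :
    Dominates (· < ·) (bumpInsert rowBumps x r).1 s := by
  induction r generalizing s with
  | nil =>
    cases s with
    | nil => exact .nil_right _ _
    | cons b s => exact h.elim
  | cons a r ih =>
    cases s with
    | nil => exact .nil_right _ _
    | cons b s =>
      by_cases hx : x < a
      · simp only [bumpInsert, rowBumps, hx, decide_true, if_true]
        exact ⟨hx.trans h.1, h.2⟩
      · simp only [bumpInsert, rowBumps, hx, decide_false, Bool.false_eq_true, if_false]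
        exact ⟨h.1, ih h.2⟩

/-- The letter bumped from a row is inserted in the next row weakly to the left. -/
lemma dominates_bumpInsert {x y : Fin n} {r s : List (Fin n)} (h : Dominates (· < ·) r s)
    (hy : (bumpInsert rowBumps x r).2 = some y) :
    Dominates (· < ·) (bumpInsert rowBumps x r).1 (bumpInsert rowBumps y s).1 := by
  induction r generalizing s with
  | nil => simp [bumpInsert] at hy
  | cons a r ih =>
    by_cases hx : x < a
    · simp only [bumpInsert, rowBumps, hx, decide_true, if_true, Option.some.injEq] at hy ⊢
      subst hy
      cases s with
      | nil => exact ⟨hx, .nil_right _ _⟩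
      | cons b s =>
        have hab : a < b := h.1
        simp only [bumpInsert, rowBumps, hab, decide_true, if_true]
        exact ⟨hx, h.2⟩
    · simp only [bumpInsert, rowBumps, hx, decide_false, Bool.false_eq_true, if_false] at hy ⊢
      have hay : a < y :=
        lt_of_le_of_lt (not_lt.1 hx) (by simpa using (mem_of_bumpInsert_snd hy).2)
      cases s with
      | nil => exact ⟨hay, .nil_right _ _⟩
      | cons b s =>
        by_cases hyb : y < b
        · simp only [bumpInsert, rowBumps, hyb, decide_true, if_true]
          exact ⟨hay, dominates_bumpInsert_left h.2⟩
        · simp only [bumpInsert, rowBumps, hyb, decide_false, Bool.false_eq_true, if_false]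
          exact ⟨h.1, ih h.2 hy⟩

lemma head?_insertLines (bumps : Fin n → Fin n → Bool) (x : Fin n) (L : List (List (Fin n))) :
    (insertLines bumps x L).head? = some (bumpInsert bumps x (L.headD [])).1 := by
  cases L with
  | nil => rfl
  | cons r L => cases h : bumpInsert bumps x r with | mk r' o => cases o <;> simp [insertLines, h]

lemma IsTableau.insertLines_row {L : List (List (Fin n))} (h : IsTableau (· < ·) (· ≤ ·) L)
    (x : Fin n) : IsTableau (· < ·) (· ≤ ·) (insertLines rowBumps x L) := by
  induction L generalizing x with
  | nil => exact ⟨by simp, by simp, by simp, trivial⟩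
  | cons r L ih =>
    obtain ⟨-, h2, h3, h4⟩ := h
    have hne := bumpInsert_fst_ne_nil rowBumps x r
    have hpw := pairwise_bumpInsert_row (x := x) h2
    cases hr : (bumpInsert rowBumps x r).2 with
    | none =>
      have : insertLines rowBumps x (r :: L) = (bumpInsert rowBumps x r).1 :: L := by
        rw [insertLines]
        split <;> simp_all
      rw [this]
      exact ⟨hne, hpw, fun d hd => dominates_bumpInsert_left (h3 d hd), h4⟩
    | some y =>
      have : insertLines rowBumps x (r :: L) =
          (bumpInsert rowBumps x r).1 :: insertLines rowBumps y L := by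
        rw [insertLines]
        split <;> simp_all
      rw [this]
      refine ⟨hne, hpw, fun d hd => ?_, ih h4 y⟩
      rw [head?_insertLines] at hd
      obtain rfl := Option.some.inj hd
      refine dominates_bumpInsert ?_ hr
      cases L with
      | nil => exact .nil_right _ _
      | cons d L => exact h3 d rfl

variable {M : Type*} [Monoid M] {f : Fin n → M}

namespace RespectsKnuth

/-- A letter `x` moves to the left through a row of larger letters, up to its first entry. -/
lemma letter_through_row (hf : RespectsKnuth f) {b x : Fin n} {r : List (Fin n)}
    (hr : (b :: r).Pairwise (· ≤ ·)) (hx : x < b) :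
    f b * ((r.map f).prod * f x) = f b * (f x * (r.map f).prod) := by
  induction r generalizing b with
  | nil => simp
  | cons c r ih =>
    rw [List.pairwise_cons] at hr
    have hbc : b ≤ c := hr.1 c (by simp)
    have h := ih hr.2 (hx.trans_le hbc)
    simp only [List.map_cons, List.prod_cons, mul_assoc] at h ⊢
    have h' := congrArg (· * (r.map f).prod) (hf.right hx hbc)
    simp only [mul_assoc] at h'
    rw [h, h']

/-- Insertion of `x` in a row: the bumped letter moves in front of the row. -/
lemma row_mul_letter (hf : RespectsKnuth f) {r : List (Fin n)} (hr : r.Pairwise (· ≤ ·))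
    (x : Fin n) : (r.map f).prod * f x =
      ((bumpInsert rowBumps x r).2.toList.map f).prod *
        ((bumpInsert rowBumps x r).1.map f).prod := by
  induction r with
  | nil => simp [bumpInsert]
  | cons b r ih =>
    have hr' := List.pairwise_cons.1 hr
    by_cases hx : x < b
    · simp only [bumpInsert, rowBumps, hx, decide_true, if_true, Option.toList_some, List.map_cons,
        List.map_nil, List.prod_cons, List.prod_nil, mul_one, mul_assoc]
      exact hf.letter_through_row hr hx
    · have ih := ih hr'.2
      simp only [bumpInsert, rowBumps, hx, decide_false, Bool.false_eq_true, if_false, List.map_cons,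
        List.prod_cons, mul_assoc]
      rw [ih]
      cases ho : bumpInsert rowBumps x r with
      | mk r' o =>
        cases o with
        | none => simp
        | some y =>
          cases r' with
          | nil => exact absurd (congrArg Prod.fst ho) (bumpInsert_fst_ne_nil _ _ _)
          | cons h t =>
            have hbh : b ≤ h := by
              have : h ∈ (bumpInsert rowBumps x r).1 := by simp [ho]
              rcases mem_bumpInsert _ _ _ _ this with rfl | hh
              · exact not_lt.1 hx
              · exact hr'.1 h hh
            have h' := congrArg (· * (t.map f).prod) (hf.left hbh (head_bumpInsert_row ho))
            simp only [mul_assoc] at h'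
            simpa using h'

/-- Row insertion of a letter multiplies the row reading by this letter on the right. -/
lemma rowWord_insertLines (hf : RespectsKnuth f) {L : List (List (Fin n))}
    (hL : ∀ r ∈ L, r.Pairwise (· ≤ ·)) (x : Fin n) :
    ((rowWord (insertLines rowBumps x L)).map f).prod = ((rowWord L).map f).prod * f x := by
  induction L generalizing x with
  | nil => simp [insertLines, rowWord]
  | cons r L ih =>
    have ih := ih (fun s hs => hL s (by simp [hs]))
    have h := hf.row_mul_letter (hL r (by simp)) x
    cases ho : bumpInsert rowBumps x r with
    | mk r' o =>
      rw [ho] at h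
      cases o with
      | none =>
        simp only [insertLines, ho, rowWord, List.map_append, List.prod_append, mul_assoc, h]
        simp
      | some y =>
        simp only [insertLines, ho, rowWord, List.map_append, List.prod_append, mul_assoc, h, ih]
        simp

/-- The column reading and the row reading of a tableau agree in the plactic monoid. -/
lemma columnWord_eq_rowWord (hf : RespectsKnuth f) {L : List (List (Fin n))}
    (hL : IsTableau (· ≤ ·) (· < ·) L) :
    ((columnWord L).map f).prod = ((rowWord (transpose L)).map f).prod := by
  induction L with
  | nil => rfl
  | cons c L ih =>
    have h := hf.column_mul_rowWord (W := []) hL.2.1 List.Pairwise.nil (by simp)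
      (hL.dominates_transpose hL.2.2.2.transpose)
    simp only [List.map_nil, List.prod_nil, mul_one, one_mul] at h
    change _ = ((rowWord (consLines c (transpose L))).map f).prod
    rw [← h, ← ih hL.2.2.2]
    simp [columnWord]

end RespectsKnuth

end RowInsertion

/-! ### Strings of two columns -/

section Pairs

variable {n : ℕ}

namespace Column

lemma length_pos (c : Column n) : 0 < c.length := List.length_pos_of_ne_nil c.isColumn.1

lemma entries_lt (c : Column n) {i j : ℕ} {x y : Fin n} (h : i < j) (hx : c.entries[i]? = some x)
    (hy : c.entries[j]? = some y) : x < y := by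
  obtain ⟨hi, rfl⟩ := List.getElem?_eq_some_iff.1 hx
  obtain ⟨hj, rfl⟩ := List.getElem?_eq_some_iff.1 hy
  exact List.pairwise_iff_getElem.1 c.isColumn.2 i j hi hj h

lemma entries_le (c : Column n) {i j : ℕ} {x y : Fin n} (h : i ≤ j) (hx : c.entries[i]? = some x)
    (hy : c.entries[j]? = some y) : x ≤ y := by
  rcases h.eq_or_lt with rfl | h
  · rw [hx] at hy
    exact (Option.some.inj hy).le
  · exact (c.entries_lt h hx hy).le

lemma exists_entry (c : Column n) {i : ℕ} (h : i < c.length) : ∃ x, c.entries[i]? = some x :=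
  ⟨_, List.getElem?_eq_getElem h⟩

lemma lt_length (c : Column n) {i : ℕ} {x : Fin n} (h : c.entries[i]? = some x) : i < c.length :=
  (List.getElem?_eq_some_iff.1 h).1

end Column

/-- The rows of `a |_r b` are weakly increasing; the entries are numbered from `0`. -/
def RowLE (a b : Column n) (r : ℤ) : Prop :=
  ∀ (i j : ℕ) (x y : Fin n), a.entries[i]? = some x → b.entries[j]? = some y →
    (i : ℤ) + b.length = r + j → x ≤ y

lemma box_pair_zero (a b : Column n) (r h : ℤ) :
    (Scol.pair a r b).box 0 h = if 1 ≤ h then a.entries[(h - 1).toNat]? else none := rfl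

lemma box_pair_one (a b : Column n) (r h : ℤ) : (Scol.pair a r b).box 1 h =
    if 1 + r - b.length ≤ h then b.entries[(h - (1 + r - b.length)).toNat]? else none := rfl

lemma box_pair_add_two (a b : Column n) (r h : ℤ) (k : ℕ) : (Scol.pair a r b).box (k + 2) h = none := rfl

lemma isRowConnected_pair {a b : Column n} {r : ℤ} :
    (Scol.pair a r b).IsRowConnected ↔ 1 ≤ r ∧ r < a.length + b.length := by
  constructor
  · rintro ⟨h, -⟩
    obtain ⟨h, h1, h2⟩ := h 0 (by simp [Scol.columns, Scol.pair])
    rw [box_pair_zero] at h1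
    rw [box_pair_one] at h2
    split_ifs at h1 h2
    · obtain ⟨x, hx⟩ := Option.isSome_iff_exists.1 h1
      obtain ⟨y, hy⟩ := Option.isSome_iff_exists.1 h2
      have := a.lt_length hx
      have := b.lt_length hy
      omega
    all_goals simp at h1 h2
  · rintro ⟨h1, h2⟩
    have ha := a.length_pos
    have hb := b.length_pos
    refine ⟨fun k hk => ?_, fun i j k h hij hjk _ hk => ?_⟩
    · obtain rfl : k = 0 := by
        simp [Scol.columns, Scol.pair] at hk
        exact hk
      refine ⟨max 1 (1 + r - b.length), ?_, ?_⟩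
      · rw [box_pair_zero, if_pos (by omega), List.getElem?_eq_getElem
          (show _ < a.length by omega)]
        rfl
      · rw [box_pair_one, if_pos (by omega), List.getElem?_eq_getElem
          (show _ < b.length by omega)]
        rfl
    · obtain ⟨k, rfl⟩ : ∃ k', k = k' + 2 := ⟨k - 2, by omega⟩
      simp [box_pair_add_two] at hk

lemma isRowIncreasing_pair {a b : Column n} {r : ℤ} :
    (Scol.pair a r b).IsRowIncreasing ↔ RowLE a b r := by
  constructor
  · intro h i j x y hx hy hij
    refine h 0 1 (i + 1) x y one_pos ?_ ?_
    · rw [box_pair_zero, if_pos (by omega)]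
      simpa using hx
    · rw [box_pair_one, if_pos (by omega)]
      convert hy using 2
      omega
  · intro h i j t x y hij hx hy
    by_cases hj : j = 1
    · obtain rfl : i = 0 := by omega
      subst hj
      rw [box_pair_zero] at hx
      rw [box_pair_one] at hy
      split_ifs at hx hy
      exact h _ _ x y hx hy (by omega)
    · obtain ⟨j, rfl⟩ : ∃ j', j = j' + 2 := ⟨j - 2, by omega⟩
      simp [box_pair_add_two] at hy

lemma isScolc_pair {a b : Column n} {r : ℤ} :
    (Scol.pair a r b).IsScolc ↔ (1 ≤ r ∧ r < a.length + b.length) ∧ RowLE a b r := by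
  rw [Scol.IsScolc, isRowConnected_pair, isRowIncreasing_pair]

/-- When the right column slides up, the rows remain increasing. -/
lemma RowLE.mono {a b : Column n} {r s : ℤ} (h : RowLE a b r) (hr : r < a.length + b.length)
    (hsr : s ≤ r) : RowLE a b s := by
  intro i j x y hx hy hij
  have hi := a.lt_length hx
  have hj := b.lt_length hy
  by_cases hlt : (i : ℤ) + (r - s) < a.length
  · obtain ⟨z, hz⟩ := a.exists_entry (i := i + (r - s).toNat) (by omega)
    exact (a.entries_le (by omega) hx hz).trans (h _ _ _ _ hz hy (by omega))
  · obtain ⟨z, hz⟩ := a.exists_entry (i := a.length - 1) (by omega)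
    obtain ⟨t, ht⟩ := b.exists_entry (i := (a.length - 1 + b.length - r).toNat) (by omega)
    exact (a.entries_le (by omega) hx hz).trans
      ((h _ _ _ _ hz ht (by omega)).trans (b.entries_le (by omega) ht hy))

/-- The positions at which two columns form a string in `Scolᶜ(n)` are `1, …, s`. -/
lemma exists_maxPosition (a b : Column n) :
    ∃ s : ℕ, IsMaxPosition a b s ∧
      ∀ r : ℤ, (Scol.pair a r b).IsScolc ↔ 1 ≤ r ∧ r ≤ s := by
  classical
  let P : ℕ → Prop := fun s => (Scol.pair a s b).IsScolc
  let N := a.length + b.length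
  have hle : ∀ r : ℤ, (Scol.pair a r b).IsScolc → 1 ≤ r ∧ r ≤ Nat.findGreatest P N := by
    intro r hr
    have h1 := (isScolc_pair.1 hr).1
    obtain ⟨m, rfl⟩ := Int.eq_ofNat_of_zero_le (by omega : 0 ≤ r)
    exact ⟨h1.1, by exact_mod_cast Nat.le_findGreatest (P := P) (by omega) hr⟩
  rcases Nat.eq_zero_or_pos (Nat.findGreatest P N) with h0 | h0
  · refine ⟨0, Or.inr ⟨rfl, fun s hs => ?_⟩, fun r => ⟨fun hr => ?_, fun hr => ?_⟩⟩
    · have := hle s hs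
      omega
    · simpa [h0] using hle r hr
    · push_cast at hr
      omega
  · have hP : P (Nat.findGreatest P N) := Nat.findGreatest_of_ne_zero rfl h0.ne'
    have hP' := isScolc_pair.1 hP
    refine ⟨Nat.findGreatest P N, Or.inl ⟨hP, fun s hs => (hle s hs).2⟩,
      fun r => ⟨hle r, fun hr => isScolc_pair.2 ⟨⟨hr.1, by omega⟩, hP'.2.mono hP'.1.2 hr.2⟩⟩⟩

lemma Column.entry_eq_some {c : Column n} {l : ℕ} {x : Fin n} :
    c.entry l = some x ↔ 1 ≤ l ∧ c.entries[l - 1]? = some x := by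
  cases l <;> simp [Column.entry]

/-- If the rows are not increasing at position `k + 1`, one row lower than position `k`, then the first
row where this fails gives the insertion at `k`. -/
lemma exists_firstInsertsAt {a b : Column n} {k : ℤ} (hk : k < b.length) {i j : ℕ} {x y : Fin n}
    (hx : a.entries[i]? = some x) (hy : b.entries[j]? = some y)
    (hij : (i : ℤ) + b.length = k + 1 + j) (hyx : y < x) :
    ∃ l m z, FirstInsertsAt a b k l m z ∧ l ≤ i + 1 := by
  classical
  have hP : ∃ i : ℕ, ∃ (j : ℕ) (x y : Fin n), a.entries[i]? = some x ∧ b.entries[j]? = some y ∧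
      (i : ℤ) + b.length = k + 1 + j ∧ y < x := ⟨i, j, x, y, hx, hy, hij, hyx⟩
  have hle := Nat.find_min' hP ⟨j, x, y, hx, hy, hij, hyx⟩
  obtain ⟨j', x', y', hx', hy', hij', hyx'⟩ := Nat.find_spec hP
  refine ⟨Nat.find hP + 1, j' + 1, y', ⟨⟨by push_cast; omega, hy', ⟨x', hx', hyx'⟩, ?_⟩, ?_⟩, by omega⟩
  · intro z hz
    rw [Column.entry_eq_some] at hz
    obtain ⟨hl, hz⟩ := hz
    simp only [Nat.add_sub_cancel] at hl hz
    have hj' := b.lt_length hy'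
    obtain ⟨t, ht⟩ := b.exists_entry (i := j' - 1) (by omega)
    have hzt : z ≤ t := by
      by_contra hlt
      exact Nat.find_min hP (Nat.sub_lt hl one_pos) ⟨j' - 1, z, t, hz, ht, by omega, not_le.1 hlt⟩
    exact hzt.trans_lt (b.entries_lt (by omega) ht hy')
  · rintro l' m' x'' ⟨h1, h2, ⟨z, hz, hxz⟩, -⟩
    rw [Column.entry_eq_some] at hz h2
    have := Nat.find_min' hP ⟨m' - 1, z, x'', hz.2, h2.2, by omega, hxz⟩
    omega

/-! ### The rules preserve the column reading in the plactic monoid -/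

/-- The word read along the columns of a string, each from bottom to top. -/
def Scol.word (w : Scol n) : List (Fin n) := columnWord (w.columns.map Column.entries)

lemma Scol.columns_glue (w w' : Scol n) (p : ℤ) : (w.glue p w').columns = w.columns ++ w'.columns := by
  cases w <;> cases w' <;> simp [Scol.glue, Scol.columns]

lemma columnWord_append {α : Type*} (L L' : List (List α)) :
    columnWord (L ++ L') = columnWord L ++ columnWord L' := by
  simp [columnWord]

lemma Scol.word_glue (w w' : Scol n) (p : ℤ) : (w.glue p w').word = w.word ++ w'.word := by
  rw [Scol.word, Scol.columns_glue, List.map_append, columnWord_append]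
  rfl

lemma Scol.word_pair (a b : Column n) (r : ℤ) :
    (Scol.pair a r b).word = a.entries.reverse ++ b.entries.reverse := by
  simp [Scol.word, Scol.pair, Scol.columns, columnWord]

lemma Scol.word_single (a : Column n) : (Scol.single a).word = a.entries.reverse := by
  simp [Scol.word, Scol.single, Scol.columns, columnWord]

variable {M : Type*} [Monoid M] {f : Fin n → M}

lemma RespectsKnuth.leftSlide (hf : RespectsKnuth f) {a b : Column n} {m : ℕ} (hm : a.length ≤ m)
    (hm' : m < b.length) (h : RowLE a b ((a.length : ℤ) + b.length - m)) :
    ((a.entries.reverse ++ b.entries.reverse).map f).prod =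
      (((a.entries ++ b.entries.drop m).reverse ++ (b.entries.take m).reverse).map f).prod := by
  have hm'' : m < b.entries.length := hm'
  have hm1 : a.entries.length ≤ m := hm
  have h1 : List.Forall₂ (· ≤ ·) a.entries ((b.entries.take m).drop (m - a.length)) := by
    rw [List.forall₂_iff_get]
    have hl : a.entries.length = ((b.entries.take m).drop (m - a.length)).length := by
      simp only [Column.length, List.length_drop, List.length_take]
      omega
    refine ⟨hl, fun i hi hi' => ?_⟩
    refine h i (m - a.length + i) _ _ (by simp) ?_ (by omega)
    simp only [List.get_eq_getElem, List.getElem_drop, List.getElem_take]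
    exact List.getElem?_eq_getElem _
  have hb : b.entries = (b.entries.take m).take (m - a.length) ++
      ((b.entries.take m).drop (m - a.length) ++ b.entries.drop m) := by
    rw [← List.append_assoc, List.take_append_drop, List.take_append_drop]
  have h2 := hf.bottom_slide (X := (b.entries.drop m).reverse) (List.rel_reverse h1) (by
    rw [← List.reverse_append]
    refine List.pairwise_reverse.2 (b.isColumn.2.sublist ?_)
    conv_rhs => rw [hb]
    exact List.sublist_append_right _ _)
  have h3 : b.entries.take m = (b.entries.take m).take (m - a.length) ++
      (b.entries.take m).drop (m - a.length) := (List.take_append_drop _ _).symm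
  conv_lhs => rw [hb]
  conv_rhs => rw [h3]
  have h4 := congrArg (· * (((b.entries.take m).take (m - a.length)).reverse.map f).prod) h2
  simp only [mul_assoc] at h4
  simp only [List.reverse_append, List.map_append, List.prod_append, mul_assoc]
  exact h4

lemma RespectsKnuth.insertSlide (hf : RespectsKnuth f) {a b d : Column n} {k : ℤ} {l m : ℕ}
    {x : Fin n} (hk : k ≤ a.length) (hk' : k < b.length) (h : RowLE a b k)
    (hl : FirstInsertsAt a b k l m x)
    (hd : d.entries = a.entries.take (l - 1) ++ x :: a.entries.drop (l - 1)) :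
    ((a.entries.reverse ++ b.entries.reverse).map f).prod =
      ((d.entries.reverse ++ (b.entries.eraseIdx (m - 1)).reverse).map f).prod := by
  obtain ⟨⟨h1, h2, ⟨z, h3, hxz⟩, -⟩, hmin⟩ := hl
  rw [Column.entry_eq_some] at h2 h3
  have hmb := b.lt_length h2.2
  have hla := a.lt_length h3.2
  have hmb' : m - 1 < b.entries.length := hmb
  have hla' : l - 1 < a.entries.length := hla
  have hx : b.entries[m - 1] = x := (List.getElem?_eq_some_iff.1 h2.2).2
  -- `b` consists of the entries above row `0`, those in the rows of `a.take (l - 1)`, shifted by one,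
  -- the entry `x`, and those in the rows of `a.drop (l - 1)`.
  have hb : b.entries = (b.entries.take (m - 1)).take (m - l) ++
      (b.entries.take (m - 1)).drop (m - l) ++ x :: b.entries.drop m := by
    rw [List.take_append_drop, ← hx]
    conv_lhs => rw [← List.take_append_drop (m - 1) b.entries, List.drop_eq_getElem_cons hmb']
    rw [Nat.sub_add_cancel h2.1]
  have key := hf.insert_slide (c := a.entries.take (l - 1)) (c' := a.entries.drop (l - 1))
    (d := (b.entries.take (m - 1)).drop (m - l)) (e := (b.entries.take (m - 1)).take (m - l))
    (d' := b.entries.drop m) (x := x) (hd ▸ d.isColumn.2) (hb ▸ b.isColumn.2) ?_ ?_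
  · rw [← hb, List.take_append_drop, List.take_append_drop, ← hd] at key
    rw [List.eraseIdx_eq_take_drop_succ, Nat.sub_add_cancel h2.1]
    simpa [List.prod_append] using key
  · rw [List.forall₂_iff_get]
    constructor
    · simp only [List.length_drop, List.length_take]
      omega
    · intro i hi hi'
      simp only [List.length_take] at hi
      by_contra hlt
      have hi2 : m - l + i < b.entries.length := by omega
      obtain ⟨l', m', x', h4, h5⟩ := exists_firstInsertsAt (a := a) (b := b) (i := i)
        (j := m - l + i) hk' (List.getElem?_eq_getElem (show i < a.entries.length by omega))
        (List.getElem?_eq_getElem hi2) (by omega) (by simpa using hlt)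
      have := hmin l' m' x' h4.1
      omega
  · rw [dominates_iff]
    refine ⟨?_, fun i y y' hy hy' => ?_⟩
    · simp only [List.length_drop]
      change b.length - m ≤ a.length - (l - 1)
      omega
    · rw [List.getElem?_drop] at hy hy'
      exact h _ _ _ _ hy hy' (by omega)

lemma IsMaxPosition.rowLE {a b : Column n} {p : ℕ} (h : IsMaxPosition a b p) : RowLE a b p := by
  rcases h with ⟨h, -⟩ | ⟨rfl, -⟩
  · exact (isScolc_pair.1 h).2
  · intro i j x y _ hy hij
    have := b.lt_length hy
    push_cast at hij
    omega

/-- The rules preserve the column reading in the plactic monoid. -/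
lemma RespectsKnuth.word_of_rule (hf : RespectsKnuth f) {ps qs pt qt : ℤ} {u v : Scol n}
    (h : FS n (ps, u, qs) (pt, v, qt)) : (u.word.map f).prod = (v.word.map f).prod := by
  rcases h with h | h | h
  · cases h with
    | alpha ci cj di dj p' q' m hm hm' h hdi hdj =>
      rw [Scol.word_pair, Scol.word_pair, hdi, hdj]
      exact hf.leftSlide hm hm' (isScolc_pair.1 h).2
    | deltaAlpha ci cj di dj p' q' q p hs hp hp' hqp ht hmin hdi hdj =>
      rw [Scol.word_pair, Scol.word_pair, hdi, hdj]
      exact hf.leftSlide hp hp' (isScolc_pair.1 ht).2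
  · cases h with
    | beta ci cj di dj p' q' k l m x hk hk' hk'' h hl hdi hdj =>
      rw [Scol.word_pair, Scol.word_pair, hdj]
      exact hf.insertSlide (by omega) (by omega) (isScolc_pair.1 h).2 hl hdi
    | deltaBeta ci cj di dj p' q' q p l t x hs hp hp' hp'' hup hl hdi hdj =>
      rw [Scol.word_pair, Scol.word_pair, hdj]
      exact hf.insertSlide (by omega) (by omega) hp.rowLE hl hdi
    | deltaBetaOne ci cj di p' q' q p l t x hs hp hp' hp'' hup hl hdi hdj =>
      have := hf.insertSlide (by omega) (by omega) hp.rowLE hl hdi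
      rw [hdj] at this
      rw [Scol.word_pair, Scol.word_single, this]
      simp
  · cases h <;> simp [Scol.word_pair]

lemma RespectsKnuth.word_of_step (hf : RespectsKnuth f) {w w' : Scol n} (h : Step (FS n) w w') :
    (w.word.map f).prod = (w'.word.map f).prod := by
  obtain ⟨w₁, w₂, u, v, ps, qs, pt, qt, hR, rfl, rfl⟩ := h
  simp only [Scol.word_glue, List.map_append, List.prod_append, hf.word_of_rule hR]

lemma RespectsKnuth.word_of_path (hf : RespectsKnuth f) {w w' : Scol n}
    (h : Relation.ReflTransGen (Step (FS n)) w w') :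
    (w.word.map f).prod = (w'.word.map f).prod := by
  induction h with
  | refl => rfl
  | tail _ h ih => exact ih.trans (hf.word_of_step h)

end Pairs

/-! ### Every pair of columns which is not a Young tableau is reducible -/

section Reducibility

variable {n : ℕ}

/-- The entry `x` can be added to the column `a` as its new `l`-th entry. -/
lemma isColumn_insert {a b : Column n} {k : ℤ} {l m : ℕ} {x : Fin n} (h : InsertsAt a b k l m x) :
    IsColumn (a.entries.take (l - 1) ++ x :: a.entries.drop (l - 1)) := by
  obtain ⟨-, -, ⟨z, hz, hxz⟩, hlt⟩ := h
  rw [Column.entry_eq_some] at hz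
  have h1 : ∀ y ∈ a.entries.take (l - 1), y < x := by
    intro y hy
    obtain ⟨i, hi, rfl⟩ := List.mem_iff_getElem.1 hy
    simp only [List.length_take, lt_min_iff] at hi
    obtain ⟨t, ht⟩ := a.exists_entry (i := l - 1 - 1) (by have := a.lt_length hz.2; omega)
    rw [List.getElem_take]
    exact (a.entries_le (by omega) (List.getElem?_eq_getElem hi.2) ht).trans_lt
      (hlt t (Column.entry_eq_some.2 ⟨by omega, ht⟩))
  have h2 : ∀ y ∈ a.entries.drop (l - 1), x < y := by
    intro y hy
    obtain ⟨i, hi, rfl⟩ := List.mem_iff_getElem.1 hy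
    rw [List.getElem_drop]
    exact hxz.trans_le (a.entries_le (by omega) hz.2 (List.getElem?_eq_getElem _))
  refine ⟨by simp, List.pairwise_append.2 ⟨a.isColumn.2.take, List.pairwise_cons.2
    ⟨h2, a.isColumn.2.drop⟩, fun y hy t ht => ?_⟩⟩
  rcases List.mem_cons.1 ht with rfl | ht
  · exact h1 y hy
  · exact (h1 y hy).trans (h2 t ht)

lemma exists_firstInsertsAt_of_not_isScolc {a b : Column n} {k : ℕ}
    (hk : k < b.length) (h : ¬ (Scol.pair a (k + 1) b).IsScolc) :
    ∃ l m x, FirstInsertsAt a b k l m x := by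
  have ha := a.length_pos
  have h' : ¬ RowLE a b (k + 1) := fun h' => h (isScolc_pair.2 ⟨⟨by omega, by omega⟩, h'⟩)
  simp only [RowLE, not_forall] at h'
  obtain ⟨i, j, x, y, hx, hy, hij, hlt⟩ := h'
  obtain ⟨l, m, z, h1, -⟩ := exists_firstInsertsAt (k := k) (by omega) hx hy hij (not_le.1 hlt)
  exact ⟨l, m, z, h1⟩

/-- A rule applies to every pair of columns, except to those which are Young tableaux. -/
lemma exists_rule {a b : Column n} {r : ℤ}
    (h : ¬ (r = b.length ∧ Dominates (· ≤ ·) a.entries b.entries)) (p' q' : ℤ) :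
    ∃ pt v qt, FS n (p', Scol.pair a r b, q') (pt, v, qt) := by
  have ha := a.length_pos
  have hb := b.length_pos
  obtain ⟨s, hs, hgood⟩ := exists_maxPosition a b
  have hdrop : ∀ m, m < b.length → IsColumn (a.entries ++ b.entries.drop m) ∨
      ¬ (a.length ≤ m ∧ (Scol.pair a ((a.length : ℤ) + b.length - m) b).IsScolc) := by
    intro m hm
    by_contra hcon
    rw [not_or, not_not] at hcon
    obtain ⟨h1, h2, h3⟩ := hcon
    refine h1 ⟨by simp [a.isColumn.1], List.pairwise_append.2 ⟨a.isColumn.2, b.isColumn.2.drop,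
      fun x hx y hy => ?_⟩⟩
    obtain ⟨i, hi, rfl⟩ := List.mem_iff_getElem.1 hx
    obtain ⟨j, hj, rfl⟩ := List.mem_iff_getElem.1 hy
    have hi' : i < a.length := hi
    obtain ⟨t, ht⟩ := b.exists_entry (i := m - a.length + i) (by omega)
    rw [List.getElem_drop]
    exact ((isScolc_pair.1 h3).2 i _ _ t (List.getElem?_eq_getElem hi) ht (by omega)).trans_lt
      (b.entries_lt (by omega) ht (List.getElem?_eq_getElem _))
  have htake : ∀ m, 0 < m → IsColumn (b.entries.take m) := by
    intro m hm
    exact ⟨by simp [b.isColumn.1]; omega, b.isColumn.2.take⟩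
  have herase : ∀ m, b.entries.eraseIdx m ≠ [] → IsColumn (b.entries.eraseIdx m) := fun m hm =>
    ⟨hm, b.isColumn.2.sublist (List.eraseIdx_sublist _ _)⟩
  have hr : r = (a.length : ℤ) + b.length - ((a.length : ℤ) + b.length - r) := by ring
  by_cases hgr : (Scol.pair a r b).IsScolc
  · -- The string is in `Scolᶜ(n)`.
    have hgr' := (hgood r).1 hgr
    rcases lt_trichotomy r b.length with hlt | heq | hgt
    · by_cases hrs : r < s
      · have hmin : (Scol.pair a (min (s : ℤ) b.length) b).IsScolc := (hgood _).2 (by omega)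
        exact ⟨_, _, _, Or.inr (Or.inr (.gamma a b p' q' r (min (s : ℤ) b.length)
          (Or.inl ⟨hgr, hgr'.1, hlt⟩) hmin (min_le_right _ _)
          (fun s' h1 h2 => le_min ((hgood s').1 h2).2 h1) (by omega)))⟩
      · obtain rfl : r = s := by omega
        by_cases hsa : s ≤ a.length
        · obtain ⟨l, m, x, hl⟩ := exists_firstInsertsAt_of_not_isScolc
            (a := a) (b := b) (k := s) (by omega)
            (fun h' => by have := (hgood _).1 h'; omega)
          have hm : m - 1 < b.entries.length := b.lt_length (Column.entry_eq_some.1 hl.1.2.1).2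
          have hne : b.entries.eraseIdx (m - 1) ≠ [] := by
            intro h0
            have h1 := congrArg List.length h0
            rw [List.length_eraseIdx_of_lt hm] at h1
            simp only [List.length_nil] at h1
            change b.length - 1 = 0 at h1
            omega
          exact ⟨_, _, _, Or.inr (Or.inl (.beta a b ⟨_, isColumn_insert hl.1⟩ ⟨_, herase _ hne⟩
            p' q' s l m x (by omega) hsa (by omega) hgr hl rfl rfl))⟩
        · have hm : (s : ℤ) = (a.length : ℤ) + b.length - (a.length + b.length - s : ℕ) := by omega
          rw [hm] at hgr ⊢
          exact ⟨_, _, _, Or.inl (.alpha a b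
            ⟨_, (hdrop _ (by omega)).resolve_right (not_not.2 ⟨by omega, hgr⟩)⟩
            ⟨_, htake (a.length + b.length - s) (by omega)⟩ p' q' _ (by omega) (by omega) hgr rfl rfl)⟩
    · subst heq
      by_cases hlen : b.length ≤ a.length
      · refine absurd ⟨rfl, dominates_iff.2 ⟨hlen, fun i x y hx hy => ?_⟩⟩ h
        exact (isScolc_pair.1 hgr).2 i i x y hx hy (by omega)
      · have hm : (b.length : ℤ) = (a.length : ℤ) + b.length - a.length := by ring
        rw [hm] at hgr ⊢
        exact ⟨_, _, _, Or.inl (.alpha a b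
          ⟨_, (hdrop _ (by omega)).resolve_right (not_not.2 ⟨by omega, hgr⟩)⟩
          ⟨_, htake a.length ha⟩ p' q' _ (by omega) (by omega) hgr rfl rfl)⟩
    · rw [hr] at hgr ⊢
      exact ⟨_, _, _, Or.inr (Or.inr (.delta a b p' q' _ (by omega) (Or.inr (Or.inl hgr))))⟩
  · by_cases hgt : (s : ℤ) < r ∨ s = 0
    · -- The right column is too low, or no position is possible.
      by_cases hsb : b.length ≤ s
      · have hgb : (Scol.pair a b.length b).IsScolc := (hgood _).2 (by omega)
        rw [hr] at hgr ⊢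
        exact ⟨_, _, _, Or.inr (Or.inr (.delta a b p' q' _ (by omega) (Or.inl ⟨hgr, hgb⟩)))⟩
      · by_cases hsa : s ≤ a.length
        · obtain ⟨l, m, x, hl⟩ := exists_firstInsertsAt_of_not_isScolc
            (a := a) (b := b) (k := s) (by omega)
            (fun h' => by have := (hgood _).1 h'; omega)
          rw [hr] at hgr ⊢
          by_cases hne : b.entries.eraseIdx (m - 1) = []
          · exact ⟨_, _, _, Or.inr (Or.inl (.deltaBetaOne a b ⟨_, isColumn_insert hl.1⟩
              p' q' _ s l m x hgr hs hsa (by omega) (by omega) hl rfl hne))⟩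
          · exact ⟨_, _, _, Or.inr (Or.inl (.deltaBeta a b ⟨_, isColumn_insert hl.1⟩
              ⟨_, herase _ hne⟩ p' q' _ s l m x hgr hs hsa (by omega) (by omega) hl rfl rfl))⟩
        · have hm : (s : ℤ) = (a.length : ℤ) + b.length - (a.length + b.length - s : ℕ) := by omega
          have hgs : (Scol.pair a s b).IsScolc := (hgood _).2 (by omega)
          rw [hm] at hgs
          rw [hr] at hgr ⊢
          exact ⟨_, _, _, Or.inl (.deltaAlpha a b
            ⟨_, (hdrop _ (by omega)).resolve_right (not_not.2 ⟨by omega, hgs⟩)⟩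
            ⟨_, htake (a.length + b.length - s) (by omega)⟩ p' q' _ _ hgr (by omega) (by omega)
            (by omega) hgs (fun t _ ht => by have := (hgood _).1 ht; omega) rfl rfl)⟩
    · -- The right column is above the left one, and position `1` is possible.
      have hr1 : r < 1 := by
        by_contra hr1
        exact hgr ((hgood r).2 (by omega))
      obtain ⟨x, hx⟩ := a.exists_entry ha
      obtain ⟨y, hy⟩ := b.exists_entry (i := b.length - 1) (by omega)
      have hxy : x ≤ y := (isScolc_pair.1 ((hgood 1).2 (by omega))).2 0 _ x y hx hy (by omega)
      have hmin : (Scol.pair a (min (s : ℤ) b.length) b).IsScolc := (hgood _).2 (by omega)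
      exact ⟨_, _, _, Or.inr (Or.inr (.gamma a b p' q' r (min (s : ℤ) b.length)
        (Or.inr ⟨fun h' => by have := isRowConnected_pair.1 h'; omega, x, y,
          Column.entry_eq_some.2 ⟨le_rfl, hx⟩, Column.entry_eq_some.2 ⟨hb, hy⟩, hxy⟩)
        hmin (min_le_right _ _)
        (fun s' h1 h2 => le_min ((hgood s').1 h2).2 h1) (by omega)))⟩

end Reducibility

/-! ### Termination -/

section Termination

variable {n : ℕ}

/-- The number of boxes of a list of columns. -/
def boxes (L : List (Column n)) : ℕ := (L.map Column.length).sum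

/-- The sum over the boxes of the number of columns to their left. -/
def leftWeight : List (Column n) → ℕ
  | [] => 0
  | _ :: L => boxes L + leftWeight L

lemma boxes_append (L L' : List (Column n)) : boxes (L ++ L') = boxes L + boxes L' := by
  simp [boxes]

lemma leftWeight_append (L L' : List (Column n)) :
    leftWeight (L ++ L') = leftWeight L + L.length * boxes L' + leftWeight L' := by
  induction L with
  | nil => simp [leftWeight]
  | cons c L ih =>
    simp only [List.cons_append, leftWeight, ih, boxes_append, List.length_cons]
    ring

/-- The left-sliding and insert-sliding rules move boxes to the left. -/
lemma leftWeight_lt_of_rule {ps qs pt qt : ℤ} {u v : Scol n}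
    (h : LS (ps, u, qs) (pt, v, qt) ∨ IS (ps, u, qs) (pt, v, qt)) :
    boxes v.columns = boxes u.columns ∧ v.columns.length ≤ u.columns.length ∧
      leftWeight v.columns < leftWeight u.columns := by
  have key : ∀ (a b d d' : Column n) (r s : ℤ), d.length + d'.length = a.length + b.length →
      d'.length < b.length →
      boxes (Scol.pair d r d').columns = boxes (Scol.pair a s b).columns ∧
      (Scol.pair d r d').columns.length ≤ (Scol.pair a s b).columns.length ∧
      leftWeight (Scol.pair d r d').columns < leftWeight (Scol.pair a s b).columns := by
    intro a b d d' r s h1 h2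
    simp only [Scol.pair, Scol.columns, boxes, leftWeight, List.map_cons, List.map_nil,
      List.sum_cons, List.sum_nil, List.length_cons]
    omega
  have hins : ∀ (a b d : Column n) (k : ℤ) (l m : ℕ) (x : Fin n), InsertsAt a b k l m x →
      d.entries = a.entries.take (l - 1) ++ x :: a.entries.drop (l - 1) →
      d.length = a.length + 1 ∧ (b.entries.eraseIdx (m - 1)).length = b.length - 1 := by
    intro a b d k l m x hl hd
    have hm : m - 1 < b.entries.length := b.lt_length (Column.entry_eq_some.1 hl.2.1).2
    obtain ⟨z, hz, -⟩ := hl.2.2.1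
    have hl' := a.lt_length (Column.entry_eq_some.1 hz).2
    refine ⟨?_, List.length_eraseIdx_of_lt hm⟩
    simp only [Column.length] at hl' ⊢
    simp only [hd, List.length_append, List.length_take, List.length_cons, List.length_drop]
    omega
  have hslide : ∀ (a b d d' : Column n) (m : ℕ), m < b.length →
      d.entries = a.entries ++ b.entries.drop m → d'.entries = b.entries.take m →
      d.length + d'.length = a.length + b.length ∧ d'.length < b.length := by
    intro a b d d' m hm hd hd'
    simp only [Column.length] at hm ⊢
    simp only [hd, hd', List.length_append, List.length_take, List.length_drop]
    omega
  rcases h with h | h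
  · cases h with
    | alpha ci cj di dj p' q' m hm hm' h hdi hdj =>
      obtain ⟨h1, h2⟩ := hslide _ _ _ _ _ hm' hdi hdj
      exact key _ _ _ _ _ _ h1 h2
    | deltaAlpha ci cj di dj p' q' q p hs hp hp' hqp ht hmin hdi hdj =>
      obtain ⟨h1, h2⟩ := hslide _ _ _ _ _ hp' hdi hdj
      exact key _ _ _ _ _ _ h1 h2
  · cases h with
    | beta ci cj di dj p' q' k l m x hk hk' hk'' h hl hdi hdj =>
      obtain ⟨h1, h2⟩ := hins _ _ _ _ _ _ _ hl.1 hdi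
      rw [← hdj] at h2
      change dj.length = _ at h2
      exact key _ _ _ _ _ _ (by omega) (by omega)
    | deltaBeta ci cj di dj p' q' q p l t x hs hp hp' hp'' hup hl hdi hdj =>
      obtain ⟨h1, h2⟩ := hins _ _ _ _ _ _ _ hl.1 hdi
      rw [← hdj] at h2
      change dj.length = _ at h2
      exact key _ _ _ _ _ _ (by omega) (by omega)
    | deltaBetaOne ci cj di p' q' q p l t x hs hp hp' hp'' hup hl hdi hdj =>
      obtain ⟨h1, h2⟩ := hins _ _ _ _ _ _ _ hl.1 hdi
      rw [hdj] at h2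
      simp only [Scol.pair, Scol.single, Scol.columns, boxes, leftWeight, List.map_cons,
        List.map_nil, List.sum_cons, List.sum_nil, List.length_cons, List.length_nil] at h2 ⊢
      omega

/-- The rows of the tops of the columns, when the top of the first column is in row `t`. -/
def Scol.tops (t : ℤ) : Scol n → List ℤ
  | .empty => []
  | .mk c l => (Scol.placeFrom t c l).map Prod.fst

/-- The rows of the tops of the columns, when the string is glued on the right of a string and its
bottom box in the first column is in row `t - 1`. -/
def Scol.gluedTops (t : ℤ) : Scol n → List ℤ
  | .empty => []
  | .mk c l => (Scol.placeFrom (t - c.length) c l).map Prod.fst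

lemma Scol.tops_pair_glue (t : ℤ) (a b : Column n) (r q : ℤ) (w : Scol n) :
    ((Scol.pair a r b).glue q w).tops t =
      t :: (t + r - b.length) :: w.gluedTops (t + r - b.length + q) := by
  cases w <;> rfl

lemma Scol.exists_tops_glue (t : ℤ) (c : Column n) (l : List (ℤ × Column n)) :
    ∃ (A : List ℤ) (e : ℤ), ∀ (p : ℤ) (d : Column n) (l' : List (ℤ × Column n)),
      ((Scol.mk c l).glue p (Scol.mk d l')).tops t = A ++ (Scol.mk d l').tops (e + p - d.length) := by
  induction l generalizing t c with
  | nil => exact ⟨[t], t, fun p d l' => rfl⟩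
  | cons q l ih =>
    obtain ⟨r, b⟩ := q
    obtain ⟨A, e, h⟩ := ih (t + r - b.length) b
    exact ⟨t :: A, e, fun p d l' => congrArg (t :: ·) (h p d l')⟩

/-- The least sum of the depths of the tops of the columns below a row `m`, over the rows `m` which
are weakly above all of the tops. The row `t` of the first top is left free, since a step may move the
first column. -/
noncomputable def heightDefect (w : Scol n) : ℕ :=
  sInf {N | ∃ t m : ℤ, (∀ s ∈ w.tops t, m ≤ s) ∧ N = ((w.tops t).map fun s => (s - m).toNat).sum}

lemma heightDefect_lt {w w' : Scol n} (h : ∀ t, ∃ (t' : ℤ) (A B : List ℤ) (x y z : ℤ),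
    w.tops t = A ++ x :: B ∧ w'.tops t' = A ++ y :: B ∧ y < x ∧ z ∈ A ++ B ∧ z ≤ y) :
    heightDefect w' < heightDefect w := by
  have hne : {N : ℕ | ∃ t m : ℤ, (∀ s ∈ w.tops t, m ≤ s) ∧
      N = ((w.tops t).map fun s => (s - m).toNat).sum}.Nonempty := by
    obtain ⟨m, hm⟩ := (w.tops 0).toFinset.bddBelow
    exact ⟨_, 0, m, fun s hs => hm (by simpa using hs), rfl⟩
  obtain ⟨t, m, hm, hN⟩ := Nat.sInf_mem hne
  obtain ⟨t', A, B, x, y, z, h1, h2, hyx, hz, hzy⟩ := h t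
  have hm' : ∀ s ∈ A ++ B, m ≤ s := fun s hs => hm s (by
    rw [h1]
    simp only [List.mem_append, List.mem_cons] at hs ⊢
    tauto)
  have hmy : m ≤ y := (hm' z hz).trans hzy
  have hle : heightDefect w' ≤ ((w'.tops t').map fun s => (s - m).toNat).sum := by
    refine Nat.sInf_le ⟨t', m, fun s hs => ?_, rfl⟩
    rw [h2] at hs
    simp only [List.mem_append, List.mem_cons] at hs
    rcases hs with hs | rfl | hs
    · exact hm' s (by simp [hs])
    · exact hmy
    · exact hm' s (by simp [hs])
  refine hle.trans_lt (lt_of_lt_of_eq ?_ hN.symm)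
  have : (y - m).toNat < (x - m).toNat := by omega
  simp only [h1, h2, List.map_append, List.map_cons, List.sum_append, List.sum_cons]
  omega

/-- The top-sliding rules move the top of a column up, and not above those of all others. -/
lemma heightDefect_lt_of_TS {w₁ w₂ u v : Scol n} {ps qs pt qt : ℤ}
    (h : TS (ps, u, qs) (pt, v, qt)) :
    heightDefect (w₁.glue pt (v.glue qt w₂)) < heightDefect (w₁.glue ps (u.glue qs w₂)) := by
  have hpair : ∀ (a b : Column n) (r q : ℤ), ∃ l, (Scol.pair a r b).glue q w₂ = Scol.mk a l := by
    intro a b r q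
    cases w₂ <;> exact ⟨_, rfl⟩
  -- The rule changes the gluing on its left from `ps` to `pt`, which moves the top of its first column
  -- from row `t` to row `t + (pt - ps)`.
  have key : (∀ t, ∃ (A B : List ℤ) (x y z : ℤ), (u.glue qs w₂).tops t = A ++ x :: B ∧
      (v.glue qt w₂).tops (t + (pt - ps)) = A ++ y :: B ∧ y < x ∧ z ∈ A ++ B ∧ z ≤ y) ∧
      ∃ a l l', u.glue qs w₂ = Scol.mk a l ∧ v.glue qt w₂ = Scol.mk a l' := by
    cases h with
    | gamma ci cj p' q' r s h hs hs' hmax hrs =>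
      obtain ⟨l, hl⟩ := hpair ci cj r qs
      obtain ⟨l', hl'⟩ := hpair ci cj s qs
      refine ⟨fun t => ⟨[], _, t, t + (ps - (s - r) - ps), t + r - cj.length,
        Scol.tops_pair_glue _ _ _ _ _ _, ?_, by omega, by simp, by omega⟩, ci, l, l', hl, hl'⟩
      rw [Scol.tops_pair_glue]
      have : t + (ps - (s - r) - ps) + s = t + r := by ring
      rw [this]
      rfl
    | delta ci cj p' q' p hp h =>
      obtain ⟨l, hl⟩ := hpair ci cj ((ci.length : ℤ) + cj.length - p) qs
      obtain ⟨l', hl'⟩ := hpair ci cj cj.length (qs + ((ci.length : ℤ) - p))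
      refine ⟨fun t => ⟨[t], _, t + ((ci.length : ℤ) + cj.length - p) - cj.length, t, t,
        Scol.tops_pair_glue _ _ _ _ _ _, ?_, by omega, by simp, le_rfl⟩, ci, l, l', hl, hl'⟩
      rw [Scol.tops_pair_glue]
      have h1 : t + (ps - ps) = t := by ring
      have h2 : t + cj.length - cj.length = t := by ring
      have h3 : t + (qs + ((ci.length : ℤ) - p)) =
        t + ((ci.length : ℤ) + cj.length - p) - cj.length + qs := by ring
      rw [h1, h2, h3]
      rfl
  obtain ⟨key, a, l, l', hl, hl'⟩ := key
  apply heightDefect_lt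
  intro t
  cases w₁ with
  | empty =>
    obtain ⟨A, B, x, y, z, h1, h2, h3⟩ := key t
    exact ⟨t + (pt - ps), A, B, x, y, z, h1, h2, h3⟩
  | mk c k =>
    obtain ⟨A, e, hA⟩ := Scol.exists_tops_glue t c k
    obtain ⟨A', B, x, y, z, h1, h2, h3, h4, h5⟩ := key (e + ps - a.length)
    refine ⟨t, A ++ A', B, x, y, z, ?_, ?_, h3, ?_, h5⟩
    · rw [hl, hA, ← hl, h1, List.append_assoc]
    · have : e + pt - a.length = e + ps - a.length + (pt - ps) := by ring
      rw [hl', hA, ← hl', this, h2, List.append_assoc]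
    · rw [List.append_assoc]
      exact List.mem_append_right _ h4

lemma Step.lex_lt {w w' : Scol n} (h : Step (FS n) w w') :
    Prod.Lex (· < ·) (· < ·) (leftWeight w'.columns, heightDefect w')
      (leftWeight w.columns, heightDefect w) := by
  obtain ⟨w₁, w₂, u, v, ps, qs, pt, qt, hR, rfl, rfl⟩ := h
  have hLI : LS (ps, u, qs) (pt, v, qt) ∨ IS (ps, u, qs) (pt, v, qt) →
      Prod.Lex (· < ·) (· < ·) (leftWeight (w₁.glue pt (v.glue qt w₂)).columns,
        heightDefect (w₁.glue pt (v.glue qt w₂))) (leftWeight (w₁.glue ps (u.glue qs w₂)).columns,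
        heightDefect (w₁.glue ps (u.glue qs w₂))) := by
    intro h
    obtain ⟨h1, h2, h3⟩ := leftWeight_lt_of_rule h
    refine Prod.Lex.left _ _ ?_
    have := Nat.mul_le_mul_right (boxes w₂.columns) h2
    simp only [Scol.columns_glue, leftWeight_append, boxes_append, h1]
    omega
  rcases hR with h | h | h
  · exact hLI (Or.inl h)
  · exact hLI (Or.inr h)
  · have hc : (w₁.glue pt (v.glue qt w₂)).columns = (w₁.glue ps (u.glue qs w₂)).columns := by
      simp only [Scol.columns_glue]
      cases h <;> rfl
    rw [hc]
    exact Prod.Lex.right _ (heightDefect_lt_of_TS h)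

lemma wellFounded_step : WellFounded (fun w' w : Scol n => Step (FS n) w w') :=
  Subrelation.wf (fun h => h.lex_lt)
    (InvImage.wf (fun w : Scol n => (leftWeight w.columns, heightDefect w))
      (WellFounded.prod_lex wellFounded_lt wellFounded_lt))

lemma terminating : Terminating (FS n) := by
  rintro ⟨f, hf⟩
  have : ∀ w : Scol n, ∀ i, f i ≠ w := fun w =>
    wellFounded_step.induction (C := fun w => ∀ i, f i ≠ w) w fun w ih i hi =>
      ih (f (i + 1)) (hi ▸ hf i) (i + 1) rfl
  exact this (f 0) 0 rfl

end Termination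

/-! ### Normal forms are Young tableaux -/

section NormalForms

variable {n : ℕ}

/-- The columns of the string are aligned at the top and form a tableau. -/
def Scol.IsAligned : Scol n → Prop
  | .empty => True
  | .mk c l => (∀ q ∈ l, q.1 = q.2.length) ∧
      IsTableau (· ≤ ·) (· < ·) ((c :: l.map Prod.snd).map Column.entries)

lemma isAligned_of_pairs {c : Column n} {l : List (ℤ × Column n)}
    (h : ∀ (w₁ w₂ : Scol n) (ps qs r : ℤ) (a b : Column n),
      Scol.mk c l = w₁.glue ps ((Scol.pair a r b).glue qs w₂) →
      r = b.length ∧ Dominates (· ≤ ·) a.entries b.entries) : (Scol.mk c l).IsAligned := by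
  induction l generalizing c with
  | nil => exact ⟨by simp, c.isColumn.1, c.isColumn.2, by simp, trivial⟩
  | cons q l ih =>
    obtain ⟨r, b⟩ := q
    obtain ⟨h1, h2⟩ : r = b.length ∧ Dominates (· ≤ ·) c.entries b.entries := by
      cases l with
      | nil => exact h .empty .empty 0 0 r c b rfl
      | cons q l => exact h .empty (.mk q.2 l) 0 q.1 r c b rfl
    have ih := ih (c := b) fun w₁ w₂ ps qs r' a' b' h' => by
      cases w₁ with
      | empty =>
        refine h (Scol.single c) w₂ r qs r' a' b' ?_
        change (Scol.single c).glue r (Scol.mk b l) = _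
        rw [h']
        rfl
      | mk d k =>
        refine h (Scol.mk c ((r, d) :: k)) w₂ ps qs r' a' b' ?_
        change (Scol.single c).glue r (Scol.mk b l) = _
        rw [h']
        cases w₂ <;> rfl
    refine ⟨fun q hq => ?_, c.isColumn.1, c.isColumn.2, ?_, ih.2⟩
    · rcases List.mem_cons.1 hq with rfl | hq
      · exact h1
      · exact ih.1 q hq
    · simpa using h2

lemma isAligned_of_normal {w : Scol n} (h : ∀ w', ¬ Step (FS n) w w') : w.IsAligned := by
  cases w with
  | empty => trivial
  | mk c l =>
    refine isAligned_of_pairs fun w₁ w₂ ps qs r a b h' => ?_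
    by_contra hab
    obtain ⟨pt, v, qt, hv⟩ := exists_rule hab ps qs
    exact h _ ⟨w₁, w₂, _, v, ps, qs, pt, qt, hv, h', rfl⟩

lemma Scol.IsAligned.isTableau {w : Scol n} (h : w.IsAligned) :
    IsTableau (· ≤ ·) (· < ·) (w.columns.map Column.entries) := by
  cases w with
  | empty => trivial
  | mk c l => exact h.2

lemma Dominates.trans {α : Type*} {R : α → α → Prop} [IsTrans α R] {u v w : List α}
    (h : Dominates R u v) (h' : Dominates R v w) : Dominates R u w := by
  rw [dominates_iff] at h h' ⊢
  refine ⟨h'.1.trans h.1, fun i x y hx hy => ?_⟩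
  have hi : i < v.length := (List.getElem?_eq_some_iff.1 hy).1.trans_le h'.1
  exact _root_.trans (h.2 i x _ hx (List.getElem?_eq_getElem hi))
    (h'.2 i _ y (List.getElem?_eq_getElem hi) hy)

lemma IsTableau.pairwise_dominates {α : Type*} {R S : α → α → Prop} [IsTrans α R]
    {L : List (List α)} (h : IsTableau R S L) : L.Pairwise (Dominates R) := by
  induction L with
  | nil => exact List.Pairwise.nil
  | cons c L ih =>
    have ih := ih h.2.2.2
    refine List.pairwise_cons.2 ⟨fun d hd => ?_, ih⟩
    cases L with
    | nil => simp at hd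
    | cons e L =>
      have hce := h.2.2.1 e rfl
      rcases List.mem_cons.1 hd with rfl | hd
      · exact hce
      · exact hce.trans ((List.pairwise_cons.1 ih).1 d hd)

lemma Scol.IsAligned.placed {w : Scol n} (h : w.IsAligned) :
    w.placed = w.columns.map fun c => (1, c) := by
  have key : ∀ (c : Column n) (l : List (ℤ × Column n)), (∀ q ∈ l, q.1 = q.2.length) →
      Scol.placeFrom 1 c l = (c :: l.map Prod.snd).map fun c => (1, c) := by
    intro c l hl
    induction l generalizing c with
    | nil => rfl
    | cons q l ih =>
      obtain ⟨p, d⟩ := q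
      have hp : p = d.length := hl (p, d) (by simp)
      have h1 : 1 + p - d.length = 1 := by omega
      rw [Scol.placeFrom, h1, ih d fun q hq => hl q (by simp [hq])]
      rfl
  cases w with
  | empty => rfl
  | mk c l => exact key c l h.1

lemma Scol.IsAligned.box_eq_some {w : Scol n} (h : w.IsAligned) {k : ℕ} {t : ℤ} {x : Fin n} :
    w.box k t = some x ↔
      1 ≤ t ∧ ∃ c, w.columns[k]? = some c ∧ c.entries[(t - 1).toNat]? = some x := by
  rw [Scol.box, h.placed, List.getElem?_map]
  cases w.columns[k]? with
  | none => simp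
  | some c =>
    by_cases ht : 1 ≤ t <;> simp [ht]

lemma Scol.IsAligned.dominates {w : Scol n} (h : w.IsAligned) {i j : ℕ} {c d : Column n}
    (hij : i < j) (hc : w.columns[i]? = some c) (hd : w.columns[j]? = some d) :
    Dominates (· ≤ ·) c.entries d.entries := by
  obtain ⟨hi, rfl⟩ := List.getElem?_eq_some_iff.1 hc
  obtain ⟨hj, rfl⟩ := List.getElem?_eq_some_iff.1 hd
  have := List.pairwise_iff_getElem.1 h.isTableau.pairwise_dominates i j (by simpa using hi)
    (by simpa using hj) hij
  simpa using this

lemma Scol.IsAligned.isYoung {w : Scol n} (h : w.IsAligned) : w.IsYoung := by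
  refine ⟨⟨⟨fun k hk => ?_, fun i j k t hij hjk _ hkt => ?_⟩, fun i j t x y hij hx hy => ?_⟩,
    fun k p d hp hd => ?_, fun k c d hc hd => ?_⟩
  · have h1 : ∀ i < w.columns.length, (w.box i 1).isSome = true := fun i hi => by
      obtain ⟨x, hx⟩ := w.columns[i].exists_entry w.columns[i].length_pos
      exact Option.isSome_iff_exists.2
        ⟨x, h.box_eq_some.2 ⟨le_rfl, _, List.getElem?_eq_getElem hi, hx⟩⟩
    exact ⟨1, h1 k (by omega), h1 (k + 1) hk⟩
  · obtain ⟨x, hx⟩ := Option.isSome_iff_exists.1 hkt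
    obtain ⟨ht, d, hd, hx⟩ := h.box_eq_some.1 hx
    have hj : j < w.columns.length := hjk.trans (List.getElem?_eq_some_iff.1 hd).1
    have hlen : d.length ≤ w.columns[j].length :=
      (h.dominates hjk (List.getElem?_eq_getElem hj) hd).length_le
    obtain ⟨y, hy⟩ := w.columns[j].exists_entry ((d.lt_length hx).trans_le hlen)
    exact Option.isSome_iff_exists.2
      ⟨y, h.box_eq_some.2 ⟨ht, _, List.getElem?_eq_getElem hj, hy⟩⟩
  · obtain ⟨-, c, hc, hx⟩ := h.box_eq_some.1 hx
    obtain ⟨-, d, hd, hy⟩ := h.box_eq_some.1 hy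
    exact (dominates_iff.1 (h.dominates hij hc hd)).2 _ x y hx hy
  · cases w with
    | empty => simp [Scol.columns] at hd
    | mk c l =>
      simp only [Scol.gluings, Scol.columns, List.getElem?_map, List.getElem?_cons_succ,
        Option.map_eq_some_iff] at hp hd
      obtain ⟨q, hq, rfl⟩ := hp
      obtain ⟨q', hq', rfl⟩ := hd
      obtain rfl : q = q' := Option.some.inj (hq.symm.trans hq')
      exact h.1 q (List.mem_of_getElem? hq)
  · exact (h.dominates (Nat.lt_succ_self k) hc hd).length_le

/-! ### Young tableaux and their lists of columns -/

lemma Scol.columns_ofColumns (g : Column n → Column n → ℤ) (L : List (Column n)) :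
    (Scol.ofColumns g L).columns = L := by
  induction L with
  | nil => rfl
  | cons c L ih =>
    have h : ∀ p, ((Scol.single c).glue p (Scol.ofColumns g L)).columns = c :: L := fun p => by
      rw [Scol.columns_glue, ih]
      rfl
    cases L <;> exact h _

lemma map_entries_filterMap {L : List (List (Fin n))} (h : ∀ c ∈ L, IsColumn c) :
    (L.filterMap Column.ofList?).map Column.entries = L := by
  induction L with
  | nil => rfl
  | cons c L ih =>
    have hc : Column.ofList? c = some ⟨c, h c (by simp)⟩ := dif_pos (h c (by simp))
    rw [List.filterMap_cons_some hc, List.map_cons, ih fun d hd => h d (by simp [hd])]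

lemma map_entries_injective : Function.Injective (List.map (Column.entries (n := n))) :=
  List.map_injective_iff.2 fun _ _ h => Column.ext h

lemma columns_youngOfColumns {L : List (List (Fin n))} (h : ∀ c ∈ L, IsColumn c) :
    (youngOfColumns L).columns.map Column.entries = L := by
  rw [youngOfColumns, Scol.columns_ofColumns, map_entries_filterMap h]

lemma Scol.IsAligned.eq_youngOfColumns {w : Scol n} (h : w.IsAligned) :
    w = youngOfColumns (w.columns.map Column.entries) := by
  have h1 : (w.columns.map Column.entries).filterMap Column.ofList? = w.columns :=
    map_entries_injective (map_entries_filterMap fun c hc => by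
      obtain ⟨d, -, rfl⟩ := List.mem_map.1 hc
      exact d.isColumn)
  rw [youngOfColumns, h1]
  have key : ∀ (c : Column n) (l : List (ℤ × Column n)), (∀ q ∈ l, q.1 = q.2.length) →
      Scol.mk c l = Scol.ofColumns (fun _ c' => (c'.length : ℤ)) (c :: l.map Prod.snd) := by
    intro c l hl
    induction l generalizing c with
    | nil => rfl
    | cons q l ih =>
      obtain ⟨p, d⟩ := q
      have hp : p = d.length := hl (p, d) (by simp)
      subst hp
      rw [List.map_cons, Scol.ofColumns, ← ih d fun q hq => hl q (by simp [hq])]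
      rfl
  cases w with
  | empty => rfl
  | mk c l => exact key c l h.1

lemma insertAll_congr {u v : List (Fin n)}
    (h : (u.map leftAction).prod = (v.map leftAction).prod) : insertAll u [] = insertAll v [] := by
  have := congrArg Subtype.val (congrFun h ⟨[], by simp⟩)
  rwa [leftAction_prod, leftAction_prod] at this

/-- A normal form is determined by the column reading of the string: it is obtained by the left
insertion of this word. -/
lemma IsNormalFormOf.eq_youngOfColumns {w v : Scol n} (h : IsNormalFormOf (FS n) w v) :
    v = youngOfColumns (insertAll w.word []) := by
  have hv := isAligned_of_normal h.2
  rw [insertAll_congr (leftAction_respectsKnuth.word_of_path h.1), Scol.word,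
    insertAll_columnWord hv.isTableau]
  exact hv.eq_youngOfColumns

lemma exists_isNormalFormOf (w : Scol n) : ∃ v, IsNormalFormOf (FS n) w v := by
  induction w using wellFounded_step.induction with
  | _ w ih =>
    by_cases h : ∃ w', Step (FS n) w w'
    · obtain ⟨w', hw'⟩ := h
      obtain ⟨v, h1, h2⟩ := ih w' hw'
      exact ⟨v, h1.head hw', h2⟩
    · exact ⟨w, .refl, fun v hv => h ⟨v, hv⟩⟩

lemma nf_spec (w : Scol n) : IsNormalFormOf (FS n) w (nf (FS n) w) := by
  rw [nf, dif_pos (exists_isNormalFormOf w)]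
  exact (exists_isNormalFormOf w).choose_spec

lemma confluent : Confluent (FS n) := by
  intro w w₁ w₂ h₁ h₂
  obtain ⟨v₁, h₁', hn₁⟩ := exists_isNormalFormOf w₁
  obtain ⟨v₂, h₂', hn₂⟩ := exists_isNormalFormOf w₂
  have e₁ := IsNormalFormOf.eq_youngOfColumns ⟨h₁.trans h₁', hn₁⟩
  have e₂ := IsNormalFormOf.eq_youngOfColumns ⟨h₂.trans h₂', hn₂⟩
  exact ⟨v₁, h₁', (e₁.trans e₂.symm) ▸ h₂'⟩

/-! ### Schensted's insertions -/

lemma word_diagonal (w : List (Fin n)) : (diagonal w).word = w := by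
  have h : ∀ u ∈ w.splitBy (fun a b => decide (b < a)), IsColumn u.reverse := by
    intro u hu
    refine ⟨by simpa using List.ne_nil_of_mem_splitBy hu, List.pairwise_reverse.2 ?_⟩
    have := List.isChain_of_mem_splitBy hu
    simp only [decide_eq_true_eq] at this
    exact (List.isChain_iff_pairwise (R := fun a b : Fin n => b < a)).1 this
  have h1 : (w.splitBy (fun a b => decide (b < a))).filterMap
      (fun u => Column.ofList? u.reverse) =
      ((w.splitBy (fun a b => decide (b < a))).map List.reverse).filterMap Column.ofList? := by
    rw [List.filterMap_map]
    rfl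
  rw [Scol.word, diagonal, Scol.columns_ofColumns, h1, map_entries_filterMap (fun c hc => by
    obtain ⟨u, hu, rfl⟩ := List.mem_map.1 hc
    exact h u hu),
    columnWord, List.flatMap_map]
  simp only [List.reverse_reverse]
  conv_rhs => rw [← List.flatten_splitBy (fun a b => decide (b < a)) w]
  simp [List.flatMap_def]

lemma nf_diagonal (w : List (Fin n)) :
    nf (FS n) (diagonal w) = youngOfColumns (insertAll w []) := by
  have := (nf_spec (diagonal w)).eq_youngOfColumns
  rwa [word_diagonal] at this

lemma constructorYcol_eq (w : List (Fin n)) :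
    constructorYcol w = youngOfColumns (insertAll w []) := by
  induction w with
  | nil => rfl
  | cons x w ih =>
    change leftInsert x (constructorYcol w) = _
    rw [ih, leftInsert, columns_youngOfColumns (isColumn_insertAll w (by simp))]
    rfl

lemma IsTableau.isColumn {L : List (List (Fin n))} (h : IsTableau (· ≤ ·) (· < ·) L) :
    ∀ c ∈ L, IsColumn c := fun c hc => ⟨h.ne_nil c hc, h.pairwise c hc⟩

/-- Row insertion of `x` in a tableau multiplies its column reading by `x` on the right, in the plactic
monoid. -/
lemma exists_rightInsert {L : List (List (Fin n))} (hL : IsTableau (· ≤ ·) (· < ·) L) (x : Fin n) :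
    ∃ L', IsTableau (· ≤ ·) (· < ·) L' ∧ rightInsert (youngOfColumns L) x = youngOfColumns L' ∧
      ((columnWord L').map leftAction).prod = ((columnWord L).map leftAction).prod * leftAction x := by
  have hf := leftAction_respectsKnuth (n := n)
  have h1 := hL.transpose.insertLines_row x
  refine ⟨transpose (insertLines rowBumps x (transpose L)), h1.transpose, ?_, ?_⟩
  · rw [rightInsert, columns_youngOfColumns hL.isColumn, transposeLines_eq_transpose hL,
      transposeLines_eq_transpose h1]
  · rw [hf.columnWord_eq_rowWord h1.transpose, h1.transpose_transpose,
      hf.rowWord_insertLines hL.transpose.pairwise, hf.columnWord_eq_rowWord hL]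

lemma constructorYrow_eq (w : List (Fin n)) :
    constructorYrow w = youngOfColumns (insertAll w []) := by
  have key : ∃ L, IsTableau (· ≤ ·) (· < ·) L ∧ constructorYrow w = youngOfColumns L ∧
      ((columnWord L).map leftAction).prod = (w.map leftAction).prod := by
    induction w using List.reverseRecOn with
    | nil => exact ⟨[], trivial, rfl, rfl⟩
    | append_singleton w x ih =>
      obtain ⟨L, h1, h2, h3⟩ := ih
      obtain ⟨L', h1', h2', h3'⟩ := exists_rightInsert h1 x
      refine ⟨L', h1', ?_, ?_⟩
      · rw [← h2', ← h2]
        simp [constructorYrow]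
      · rw [h3', h3]
        simp
  obtain ⟨L, h1, h2, h3⟩ := key
  rw [h2, ← insertAll_congr h3, insertAll_columnWord h1]

end NormalForms

end JeuDeTaquin

theorem theoremT (n : ℕ) :
    JeuDeTaquin.Convergent (JeuDeTaquin.FS n) ∧
    (∀ w : JeuDeTaquin.Scol n, ∃! v, JeuDeTaquin.IsNormalFormOf (JeuDeTaquin.FS n) w v) ∧
    (∀ w : JeuDeTaquin.Scol n, w.IsSkew → (JeuDeTaquin.nf (JeuDeTaquin.FS n) w).IsYoung) ∧
    (∀ w : List (Fin n), JeuDeTaquin.constructorYrow w =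
      JeuDeTaquin.nf (JeuDeTaquin.FS n) (JeuDeTaquin.diagonal w)) ∧
    (∀ w : List (Fin n), JeuDeTaquin.constructorYcol w =
      JeuDeTaquin.nf (JeuDeTaquin.FS n) (JeuDeTaquin.diagonal w)) := by
  refine ⟨⟨JeuDeTaquin.confluent, JeuDeTaquin.terminating⟩,
    fun w => ⟨_, JeuDeTaquin.nf_spec w, fun v hv =>
      hv.eq_youngOfColumns.trans (JeuDeTaquin.nf_spec w).eq_youngOfColumns.symm⟩,
    fun w _ => (JeuDeTaquin.isAligned_of_normal (JeuDeTaquin.nf_spec w).2).isYoung,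
    fun w => ?_, fun w => ?_⟩
  · rw [JeuDeTaquin.nf_diagonal, JeuDeTaquin.constructorYrow_eq]
  · rw [JeuDeTaquin.nf_diagonal, JeuDeTaquin.constructorYcol_eq]
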